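/- For $m\ge 1$ let $K=\mathbb Q(\zeta_m)$ be the $m$-th cyclotomic field, with ring of integers $\mathcal O_K$, discriminant $d_K$ and degree $\phi(m)$, and let $K_{\mathbb R}=K\otimes_{\mathbb Q}\mathbb R$ be the Euclidean space of dimension $\phi(m)$ whose scalar product is induced by the trace form $\langle x,y\rangle=\mathrm{tr}(x\overline y)=\sum_{\tau:K\to\mathbb C}\tau(x)\overline{\tau(y)}$. Let $E=K_{\mathbb R}^2$ with the scalar product $\langle x,y\rangle=\langle x_1,y_1\rangle+\langle x_2,y_2\rangle$; it is a Euclidean space of dimension $2\phi(m)$. In a Euclidean space of dimension $n$, the dual of a lattice $\Lambda$ is $\Lambda^\#=\{x:\langle x,y\rangle\in\mathbb Z\ \forall y\in\Lambda\}$. The lattice $\Lambda$ is called symplectic if there is an isometry $\sigma$ of the space with $\sigma(\Lambda)=\Lambda^\#$ and $\sigma^2=-\mathrm{Id}$. Its packing density is $\Delta(\Lambda)=\mathrm{Vol}(B(\mu))/(2^n\,\mathrm{Vol}(\Lambda))$, where $\mu=\min\{\|x\|: x\in\Lambda\setminus\{0\}\}$, $B(\mu)$ is the ball of radius $\mu$,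 and $\mathrm{Vol}(\Lambda)$ is the volume of a fundamental region. For every $m\ge1$ let $\mathfrak P=\mathfrak P_m$ be a prime ideal of $\mathcal O_K$ lying over a prime number that does not divide $m$, and put $F=\mathcal O_K/\mathfrak P$ and $q=q_m=|F|$. Let $\alpha=(q|d_K|)^{1/(2\phi(m))}$, let $\mathcal O_K^\#$ be the dual lattice of $\mathcal O_K$ in $K_{\mathbb R}$, and let $$\Lambda_0=\alpha^{-1}\mathcal O_K\times\alpha\,\mathfrak P^{-1}\mathcal O_K^\#\subset E .$$ With $\pi:\Lambda_0\to\Lambda_0/\mathfrak P\Lambda_0$ the canonical surjection, let $\mathcal L_{\mathcal C}=\mathcal L_{\mathcal C,m}$ be the family of the lattices $\Lambda_C=\pi^{-1}(C)$, where $C$ runs over the one-dimensional $F$-subspaces of the $F$-vector space $\Lambda_0/\mathfrak P\Lambda_0$. Theorem. Let $0<\varepsilon<1$, and suppose that $\phi(m)^2m=o\big(q_m^{1/\phi(m)}\big)$ as $m\to\infty$. Then for all sufficiently large $m$, every lattice in $\mathcal L_{\mathcal C}$ is a symplectic lattice of $E\cong\mathbb R^{2\phi(m)}$, and $\mathcal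 L_{\mathcal C}$ contains a lattice $\Lambda$ with $$\Delta(\Lambda)>\frac{(1-\varepsilon)\,m}{2^{2\phi(m)}} .$$ -/

import Mathlib

open scoped NumberField TensorProduct ComplexConjugate Pointwise
open Filter Asymptotics MeasureTheory

noncomputable section

/-! ## Lattices in Euclidean spaces -/

section Lattices

variable {E : Type*} [NormedAddCommGroup E] [InnerProductSpace ℝ E]

/-- A lattice in `E`: a discrete subgroup that spans `E` over `ℝ` (equivalently, in finite
dimension `n`, a discrete free `ℤ`-module of rank `n`). -/
def IsEuclideanLattice (Λ : Submodule ℤ E) : Prop :=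
  DiscreteTopology Λ ∧ Submodule.span ℝ (Λ : Set E) = ⊤

/-- The dual lattice `Λ^# = {x | ∀ y ∈ Λ, ⟪x, y⟫ ∈ ℤ}`. -/
def dualLattice (Λ : Submodule ℤ E) : Submodule ℤ E where
  carrier := {x | ∀ y ∈ Λ, ∃ k : ℤ, inner ℝ x y = (k : ℝ)}
  zero_mem' := fun y _ => ⟨0, by simp⟩
  add_mem' := by
    intro a b ha hb y hy
    obtain ⟨k, hk⟩ := ha y hy
    obtain ⟨l, hl⟩ := hb y hy
    exact ⟨k + l, by rw [inner_add_left, hk, hl]; push_cast; rfl⟩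
  smul_mem' := by
    intro c x hx y hy
    obtain ⟨k, hk⟩ := hx y hy
    refine ⟨c * k, ?_⟩
    rw [← Int.cast_smul_eq_zsmul ℝ c x, real_inner_smul_left, hk]
    push_cast
    rfl

/-- A lattice `Λ` is symplectic if there is an isometry `σ` of `E` with `σ(Λ) = Λ^#` and
`σ² = -Id`. -/
def IsSymplecticLattice (Λ : Submodule ℤ E) : Prop :=
  IsEuclideanLattice Λ ∧
    ∃ σ : E ≃ₗᵢ[ℝ] E, σ '' (Λ : Set E) = (dualLattice Λ : Set E) ∧ ∀ x, σ (σ x) = -x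

/-- The minimum `μ_Λ = min {‖x‖ | x ∈ Λ \ {0}}`. -/
def latticeMinimum (Λ : Submodule ℤ E) : ℝ :=
  sInf {r : ℝ | ∃ x ∈ Λ, x ≠ 0 ∧ r = ‖x‖}

/-- The packing density `Δ(Λ) = Vol(B(μ_Λ)) / (2^n Vol(Λ))`, where `n = dim E` and `Vol(Λ)` is the
volume of a fundamental region. -/
def latticeDensity [FiniteDimensional ℝ E] [MeasurableSpace E] [BorelSpace E]
    (Λ : Submodule ℤ E) : ℝ :=
  (volume : Measure E).real (Metric.closedBall 0 (latticeMinimum Λ)) /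
    (2 ^ Module.finrank ℝ E * ZLattice.covolume Λ)

end Lattices

/-! ## The Euclidean space `K_ℝ` of a number field -/

/-- `K_ℝ = ℝ ⊗ K`. -/
def RealSpace (K : Type*) [Field K] [NumberField K] : Type _ := ℝ ⊗[ℚ] K

namespace RealSpace

variable (K : Type*) [Field K] [NumberField K]

instance : CommRing (RealSpace K) := inferInstanceAs (CommRing (ℝ ⊗[ℚ] K))

instance : Algebra ℝ (RealSpace K) := inferInstanceAs (Algebra ℝ (ℝ ⊗[ℚ] K))

/-- The natural embedding `K → K_ℝ`, `x ↦ 1 ⊗ x`. -/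
instance : Algebra K (RealSpace K) :=
  (Algebra.TensorProduct.includeRight : K →ₐ[ℚ] ℝ ⊗[ℚ] K).toRingHom.toAlgebra

instance : Module.Finite ℝ (RealSpace K) := inferInstanceAs (Module.Finite ℝ (ℝ ⊗[ℚ] K))

variable {K}

theorem algebraMap_eq (x : K) : algebraMap K (RealSpace K) x = (1 : ℝ) ⊗ₜ[ℚ] x := rfl

/-- The `ℝ`-algebra homomorphism `K_ℝ → ℂ` that extends an embedding `τ : K → ℂ`. -/
def embed (τ : K →+* ℂ) : RealSpace K →ₐ[ℝ] ℂ :=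
  Algebra.TensorProduct.lift (Algebra.ofId ℝ ℂ) τ.toRatAlgHom (fun _ _ => Commute.all _ _)

theorem embed_algebraMap (τ : K →+* ℂ) (x : K) : embed τ (algebraMap K (RealSpace K) x) = τ x := by
  rw [algebraMap_eq]
  exact (Algebra.TensorProduct.lift_tmul _ _ _ _ _).trans (by simp)

theorem eq_zero_of_embed (x : RealSpace K) (h : ∀ τ : K →+* ℂ, embed τ x = 0) : x = 0 := by
  let b : Module.Basis _ ℝ (RealSpace K) :=
    Algebra.TensorProduct.basis ℝ (NumberField.integralBasis K)
  have hb : ∀ (τ : K →+* ℂ) i,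
      embed τ (b i) = NumberField.canonicalEmbedding.latticeBasis K i τ := by
    intro τ i
    rw [NumberField.canonicalEmbedding.latticeBasis_apply]
    have h1 : b i = algebraMap K (RealSpace K) (NumberField.integralBasis K i) :=
      Algebra.TensorProduct.basis_apply _ _
    rw [h1, embed_algebraMap]
    rfl
  have h0 : ∑ i, ((b.repr x i : ℝ) : ℂ) • NumberField.canonicalEmbedding.latticeBasis K i = 0 := by
    funext τ
    have h1 := h τ
    rw [← b.sum_repr x, map_sum] at h1
    rw [Finset.sum_apply, Pi.zero_apply, ← h1]
    refine Finset.sum_congr rfl fun i _ => ?_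
    rw [map_smul, hb]
    simp
  have h2 := Fintype.linearIndependent_iff.mp
    (NumberField.canonicalEmbedding.latticeBasis K).linearIndependent _ h0
  rw [← b.sum_repr x]
  refine Finset.sum_eq_zero fun i _ => ?_
  have h3 : b.repr x i = 0 := by exact_mod_cast h2 i
  rw [h3, zero_smul]

/-- The scalar product `⟨x, y⟩ = tr(x ȳ) = ∑_τ τ(x) conj(τ(y))` on `K_ℝ`, where `τ` runs over the
embeddings of `K` in `ℂ`. (The sum is real; see also `inner_algebraMap`.) -/
instance innerCore : InnerProductSpace.Core ℝ (RealSpace K) where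
  inner x y := ∑ τ : K →+* ℂ, (embed τ x * conj (embed τ y)).re
  conj_inner_symm x y := by
    simp only [conj_trivial]
    refine Finset.sum_congr rfl fun τ _ => ?_
    simp only [Complex.mul_re, Complex.conj_re, Complex.conj_im]
    ring
  re_inner_nonneg x := by
    simp only [RCLike.re_to_real]
    refine Finset.sum_nonneg fun τ _ => ?_
    rw [Complex.mul_conj, Complex.ofReal_re]
    exact Complex.normSq_nonneg _
  add_left x y z := by
    rw [← Finset.sum_add_distrib]
    refine Finset.sum_congr rfl fun τ _ => ?_
    rw [map_add, add_mul, Complex.add_re]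
  smul_left x y r := by
    simp only [conj_trivial]
    rw [Finset.mul_sum]
    refine Finset.sum_congr rfl fun τ _ => ?_
    rw [map_smul, smul_mul_assoc, Complex.smul_re, smul_eq_mul]
  definite x hx := by
    refine eq_zero_of_embed x fun τ => ?_
    have h := (Finset.sum_eq_zero_iff_of_nonneg (fun τ _ => ?_)).mp hx τ (Finset.mem_univ τ)
    · rw [Complex.mul_conj, Complex.ofReal_re] at h
      exact Complex.normSq_eq_zero.mp h
    · rw [Complex.mul_conj, Complex.ofReal_re]
      exact Complex.normSq_nonneg _

instance : NormedAddCommGroup (RealSpace K) :=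
  InnerProductSpace.Core.toNormedAddCommGroup (𝕜 := ℝ) (cd := innerCore)

instance : InnerProductSpace ℝ (RealSpace K) := InnerProductSpace.ofCore _

theorem inner_def (x y : RealSpace K) :
    inner ℝ x y = ∑ τ : K →+* ℂ, (embed τ x * conj (embed τ y)).re := rfl

/-- On `K` the scalar product is the trace form `tr(x ȳ)`, as soon as `ȳ` makes sense in `K`. -/
theorem inner_algebraMap (x y z : K) (hz : ∀ τ : K →+* ℂ, τ z = conj (τ y)) :
    inner ℝ (algebraMap K (RealSpace K) x) (algebraMap K (RealSpace K) y) =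
      ((Algebra.trace ℚ K (x * z) : ℚ) : ℝ) := by
  have h := trace_eq_sum_embeddings (K := ℚ) (L := K) ℂ (x := x * z)
  have h2 : ((Algebra.trace ℚ K (x * z) : ℚ) : ℂ) = ∑ τ : K →+* ℂ, τ x * conj (τ y) := by
    rw [show ((Algebra.trace ℚ K (x * z) : ℚ) : ℂ) = algebraMap ℚ ℂ _ from
      (eq_ratCast (algebraMap ℚ ℂ) _).symm, h]
    refine (Fintype.sum_equiv (RingHom.equivRatAlgHom K ℂ) _ _ fun τ => ?_).symm
    rw [map_mul, ← hz]
    rfl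
  rw [inner_def]
  simp only [embed_algebraMap]
  rw [← Complex.re_sum, ← h2, Complex.ratCast_re]

instance : MeasurableSpace (RealSpace K) := borel _

instance : BorelSpace (RealSpace K) := ⟨rfl⟩

end RealSpace

/-! ## The lattices constructed from lines -/

section Construction

variable {K : Type*} [Field K] [NumberField K]

variable (K) in
/-- The image of `𝓞 K` in `K_ℝ`. -/
def integersLattice : Submodule (𝓞 K) (RealSpace K) :=
  LinearMap.range (Algebra.linearMap (𝓞 K) (RealSpace K))

/-- The lattice `𝔓⁻¹ 𝓞_K^#` of `K_ℝ`, where `𝓞_K^#` is the dual lattice of `𝓞_K`: the set of finite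
sums of products `a • z` with `a ∈ 𝔓⁻¹` and `z ∈ 𝓞_K^#`. -/
def invMulDual (P : Ideal (𝓞 K)) : Submodule (𝓞 K) (RealSpace K) :=
  Submodule.span (𝓞 K) {x | ∃ a ∈ (P : FractionalIdeal (nonZeroDivisors (𝓞 K)) K)⁻¹,
    ∃ z ∈ dualLattice ((integersLattice K).restrictScalars ℤ), x = a • z}

/-- `q = |𝓞_K / 𝔓|`. -/
def residueCard (P : Ideal (𝓞 K)) : ℕ := Nat.card (𝓞 K ⧸ P)

/-- `α = (q |d_K|)^(1 / (2 [K : ℚ]))`. -/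
def scalingFactor (P : Ideal (𝓞 K)) : ℝ :=
  ((residueCard P : ℝ) * |(NumberField.discr K : ℝ)|) ^ (1 / (2 * (Module.finrank ℚ K : ℝ)))

variable (K) in
/-- The Euclidean space `E = K_ℝ²`. -/
abbrev RealPlane : Type _ := WithLp 2 (RealSpace K × RealSpace K)

/-- `Λ₀ = α⁻¹ 𝓞_K × α 𝔓⁻¹ 𝓞_K^#`, as an `𝓞_K`-submodule of `E = K_ℝ²`. -/
def baseLattice (P : Ideal (𝓞 K)) : Submodule (𝓞 K) (RealPlane K) :=
  (((scalingFactor P)⁻¹ • integersLattice K).prod (scalingFactor P • invMulDual P)).comap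
    (WithLp.linearEquiv 2 (𝓞 K) (RealSpace K × RealSpace K)).toLinearMap

/-- `Λ₀ / 𝔓Λ₀`, a module over `F = 𝓞_K / 𝔓`. -/
abbrev CodeSpace (P : Ideal (𝓞 K)) : Type _ :=
  baseLattice P ⧸ (P • (⊤ : Submodule (𝓞 K) (baseLattice P)))

/-- The lattice `Λ_C = π⁻¹(C)`, where `π : Λ₀ → Λ₀ / 𝔓Λ₀` is the canonical surjection. -/
def codeLattice (P : Ideal (𝓞 K)) (C : Submodule (𝓞 K ⧸ P) (CodeSpace P)) :
    Submodule ℤ (RealPlane K) :=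
  AddSubgroup.toIntSubmodule
    ((C.toAddSubgroup.comap
      (P • (⊤ : Submodule (𝓞 K) (baseLattice P))).mkQ.toAddMonoidHom).map
        (baseLattice P).subtype.toAddMonoidHom)

/-- The family `𝓛_𝓒` of the lattices `Λ_C`, where `C` runs over the `F`-lines of `Λ₀ / 𝔓Λ₀`. -/
def lineLattices (P : Ideal (𝓞 K)) : Set (Submodule ℤ (RealPlane K)) :=
  {Λ | ∃ C : Submodule (𝓞 K ⧸ P) (CodeSpace P), Module.finrank (𝓞 K ⧸ P) C = 1 ∧
    Λ = codeLattice P C}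

theorem mem_codeLattice (P : Ideal (𝓞 K)) (C : Submodule (𝓞 K ⧸ P) (CodeSpace P))
    (x : RealPlane K) :
    x ∈ codeLattice P C ↔ ∃ h : x ∈ baseLattice P,
      (Submodule.Quotient.mk ⟨x, h⟩ : CodeSpace P) ∈ C := by
  constructor
  · rintro ⟨y, hy, rfl⟩
    exact ⟨y.2, hy⟩
  · rintro ⟨h, hx⟩
    exact ⟨⟨x, h⟩, hx, rfl⟩

end Construction

end

/-!
The idea is to average over the lines `C`. Let `K²` carry the form `x₁ y₂ - x₂ y₁`. Complex
conjugation of `K` turns it into the isometry `σ : (x, y) ↦ (-ȳ, x̄)` of `E`, and carries the dual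
of an `𝓞 K`-lattice for the form, relative to the codifferent, to its Euclidean dual. The scaling
factor `α` is irrelevant to this, and `Λ₀` and `𝔓 Λ₀` are symplectically dual to each other. A
line is its own orthogonal space for an alternating form on a plane, so every `Λ_C`, which lies
between these two, is carried to its dual by `σ`, and in particular has covolume `1`.

Distinct `Λ_C` meet in `𝔓 Λ₀` only, which has no nonzero vectors of length at most `r`, by the
inequality between the arithmetic and the geometric mean. If every `Λ_C` contained a nonzero
vector of length at most `r`, its multiples by the `m`-th roots of unity would give `m` such
vectors for each of the `q + 1` lines, all distinct. Balls of radius `r + ρ`, with `ρ` the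
covering radius of `Λ₀`, have room for at most `vol B(r + ρ) / vol Λ₀` points of `Λ₀` of length at
most `r`, and `vol Λ₀ ≥ 1 / (q + 1)`. Hence some `Λ_C` has no such vector as soon as
`vol B(r + ρ) < m`. The growth condition on `q` makes `n ρ / r` tend to zero, which allows
`vol B(r)` to be `κ m` for any `κ < 1`.
-/

noncomputable section

/-! ## The codifferent and the dual of the ring of integers -/

open FractionalIdeal nonZeroDivisors in
/-- The codifferent of `K`, that is the dual of `𝓞 K` for the trace form. -/
abbrev codifferent (K : Type*) [Field K] [NumberField K] : FractionalIdeal (𝓞 K)⁰ K := dual ℤ ℚ 1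

namespace RealSpace

variable {K : Type*} [Field K] [NumberField K]

/-- The `ℝ`-basis of `K_ℝ` given by a `ℚ`-basis of `K`. -/
def realBasis {ι : Type*} (b : Module.Basis ι ℚ K) : Module.Basis ι ℝ (RealSpace K) :=
  Algebra.TensorProduct.basis ℝ b

theorem realBasis_apply {ι : Type*} (b : Module.Basis ι ℚ K) (i : ι) :
    realBasis b i = algebraMap K (RealSpace K) (b i) :=
  Algebra.TensorProduct.basis_apply _ _

theorem finrank_eq : Module.finrank ℝ (RealSpace K) = Module.finrank ℚ K := by
  rw [Module.finrank_eq_card_basis (realBasis (Module.finBasis ℚ K)), Fintype.card_fin]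

theorem algebraMap_injective : Function.Injective (algebraMap K (RealSpace K)) :=
  have : Nontrivial (RealSpace K) := inferInstanceAs (Nontrivial (ℝ ⊗[ℚ] K))
  (algebraMap K (RealSpace K)).injective

theorem embed_smul (τ : K →+* ℂ) (a : K) (x : RealSpace K) :
    embed τ (a • x) = τ a * embed τ x := by
  rw [Algebra.smul_def, map_mul, embed_algebraMap]

theorem norm_sq (x : RealSpace K) : ‖x‖ ^ 2 = ∑ τ : K →+* ℂ, ‖embed τ x‖ ^ 2 := by
  rw [← real_inner_self_eq_norm_sq, inner_def]
  refine Finset.sum_congr rfl fun τ _ => ?_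
  rw [Complex.mul_conj, Complex.ofReal_re, Complex.normSq_eq_norm_sq]

theorem ext_embed {x y : RealSpace K} (h : ∀ τ : K →+* ℂ, embed τ x = embed τ y) : x = y :=
  sub_eq_zero.mp (eq_zero_of_embed _ fun τ => by rw [map_sub, h, sub_self])

/-- The `ℝ`-linear extension to `K_ℝ` of the trace of `K` over `ℚ`. -/
def realTrace : RealSpace K →ₗ[ℝ] ℝ :=
  ∑ τ : K →+* ℂ, Complex.reLm ∘ₗ (embed τ).toLinearMap

theorem realTrace_apply (x : RealSpace K) : realTrace x = ∑ τ : K →+* ℂ, (embed τ x).re := by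
  simp [realTrace]

theorem realTrace_algebraMap (a : K) :
    realTrace (algebraMap K (RealSpace K) a) = ((Algebra.trace ℚ K a : ℚ) : ℝ) := by
  have h := inner_algebraMap a 1 1 (fun τ => by simp)
  rw [mul_one] at h
  rw [← h, realTrace_apply, inner_def]
  simp

theorem repr_realBasis_traceDual {ι : Type*} [Finite ι] [DecidableEq ι] (b : Module.Basis ι ℚ K)
    (x : RealSpace K) (i : ι) :
    (realBasis b.traceDual).repr x i = realTrace (x * algebraMap K (RealSpace K) (b i)) := by
  suffices h : (realBasis b.traceDual).coord i =
      realTrace ∘ₗ LinearMap.mulRight ℝ (algebraMap K (RealSpace K) (b i)) from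
    LinearMap.congr_fun h x
  refine (realBasis b.traceDual).ext fun j => ?_
  rw [Module.Basis.coord_apply, Module.Basis.repr_self, LinearMap.comp_apply,
    LinearMap.mulRight_apply, realBasis_apply, ← map_mul, realTrace_algebraMap,
    Module.Basis.trace_traceDual_mul, Finsupp.single_apply]
  split_ifs <;> simp_all

/-- The field endomorphism `c` of `K` is complex conjugation under every complex embedding. Such a
`c` exists exactly if `K` is totally real or a CM field. -/
def IsComplexConjugation (c : K →+* K) : Prop :=
  ∀ (τ : K →+* ℂ) (a : K), τ (c a) = conj (τ a)

theorem IsComplexConjugation.apply_apply {c : K →+* K} (hc : IsComplexConjugation c) (a : K) :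
    c (c a) = a := by
  obtain ⟨τ⟩ : Nonempty (K →+* ℂ) := inferInstance
  exact τ.injective (by rw [hc, hc, Complex.conj_conj])

/-- The `ℝ`-linear extension to `K_ℝ` of an endomorphism of `K`. -/
def extend (c : K →+* K) : RealSpace K →ₐ[ℝ] RealSpace K :=
  (Algebra.TensorProduct.map (AlgHom.id ℝ ℝ) c.toRatAlgHom : ℝ ⊗[ℚ] K →ₐ[ℝ] ℝ ⊗[ℚ] K)

theorem extend_algebraMap (c : K →+* K) (a : K) :
    extend c (algebraMap K (RealSpace K) a) = algebraMap K (RealSpace K) (c a) :=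
  Algebra.TensorProduct.map_tmul _ _ _ _

section Conj

variable {c : K →+* K} (hc : IsComplexConjugation c)
include hc

theorem embed_extend (τ : K →+* ℂ) (x : RealSpace K) :
    embed τ (extend c x) = conj (embed τ x) := by
  suffices h : (embed τ).toLinearMap ∘ₗ (extend c).toLinearMap =
      Complex.conjAe.toLinearMap ∘ₗ (embed τ).toLinearMap from LinearMap.congr_fun h x
  refine (realBasis (Module.finBasis ℚ K)).ext fun i => ?_
  simp [realBasis_apply, extend_algebraMap, embed_algebraMap, hc τ]

theorem extend_extend (x : RealSpace K) : extend c (extend c x) = x :=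
  ext_embed fun τ => by rw [embed_extend hc, embed_extend hc, Complex.conj_conj]

theorem norm_extend (x : RealSpace K) : ‖extend c x‖ = ‖x‖ := by
  rw [← sq_eq_sq₀ (norm_nonneg _) (norm_nonneg _), norm_sq, norm_sq]
  refine Finset.sum_congr rfl fun τ _ => ?_
  rw [embed_extend hc, Complex.norm_conj]

/-- Complex conjugation on `K_ℝ`. -/
def conjIso : RealSpace K ≃ₗᵢ[ℝ] RealSpace K where
  toLinearEquiv := LinearEquiv.ofInvolutive (extend c).toLinearMap (extend_extend hc)
  norm_map' := norm_extend hc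

theorem conjIso_apply (x : RealSpace K) : conjIso hc x = extend c x := rfl

theorem conjIso_conjIso (x : RealSpace K) : conjIso hc (conjIso hc x) = x :=
  extend_extend hc x

theorem conjIso_algebraMap (a : K) :
    conjIso hc (algebraMap K (RealSpace K) a) = algebraMap K (RealSpace K) (c a) :=
  extend_algebraMap c a

theorem inner_conjIso_right (x y : RealSpace K) :
    inner ℝ x (conjIso hc y) = realTrace (x * y) := by
  rw [inner_def, realTrace_apply]
  refine Finset.sum_congr rfl fun τ _ => ?_
  rw [map_mul, conjIso_apply, embed_extend hc, Complex.conj_conj]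

theorem inner_conjIso_left (x y : RealSpace K) :
    inner ℝ (conjIso hc x) y = realTrace (x * y) := by
  rw [← (conjIso hc).inner_map_map, conjIso_conjIso, inner_conjIso_right]

end Conj

section Duality

open FractionalIdeal nonZeroDivisors

theorem exists_mem_dual_algebraMap_eq_iff {I : FractionalIdeal (𝓞 K)⁰ K} (hI : I ≠ 0)
    {x : RealSpace K} :
    (∃ b ∈ dual ℤ ℚ I, algebraMap K (RealSpace K) b = x) ↔
      ∀ a ∈ I, ∃ k : ℤ, realTrace (x * algebraMap K (RealSpace K) a) = k := by
  classical
  constructor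
  · rintro ⟨b, hb, rfl⟩ a ha
    obtain ⟨k, hk⟩ := (mem_dual hI).mp hb a ha
    refine ⟨k, ?_⟩
    rw [← map_mul, realTrace_algebraMap, ← Algebra.traceForm_apply, ← hk]
    simp
  · intro h
    let b := NumberField.basisOfFractionalIdeal K (Units.mk0 I hI)
    have hspan : ∀ a, a ∈ Submodule.span ℤ (Set.range b) ↔ a ∈ I := fun a =>
      NumberField.mem_span_basisOfFractionalIdeal K (I := Units.mk0 I hI)
    have hdual : ∀ i, b.traceDual i ∈ (dual ℤ ℚ I).coeToSubmodule := by
      intro i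
      rw [coe_dual ℤ ℚ hI, ← Submodule.restrictScalars_mem ℤ,
        Submodule.traceDual_span_of_basis ℤ (I : Submodule (𝓞 K) K) b
          (Submodule.ext fun a => (hspan a).symm)]
      exact Submodule.subset_span ⟨i, rfl⟩
    choose k hk using fun i => h (b i) ((hspan _).mp (Submodule.subset_span ⟨i, rfl⟩))
    refine ⟨∑ i, k i • b.traceDual i, (dual ℤ ℚ I).coeToSubmodule.sum_mem
      fun i _ => zsmul_mem (hdual i) (k i), ?_⟩
    rw [← (realBasis b.traceDual).sum_repr x, map_sum]
    refine Finset.sum_congr rfl fun i _ => ?_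
    rw [repr_realBasis_traceDual, hk, map_zsmul, realBasis_apply, Int.cast_smul_eq_zsmul]

theorem mem_codifferent_iff {d : K} :
    d ∈ codifferent K ↔
      ∀ r : 𝓞 K, ∃ k : ℤ, realTrace (algebraMap K (RealSpace K) (r • d)) = k := by
  have h := exists_mem_dual_algebraMap_eq_iff (one_ne_zero' (FractionalIdeal (𝓞 K)⁰ K))
    (x := algebraMap K (RealSpace K) d)
  simp only [algebraMap_injective.eq_iff, exists_eq_right] at h
  rw [h]
  simp [mem_one_iff, Algebra.smul_def, mul_comm]

theorem span_image_fractionalIdeal {I : FractionalIdeal (𝓞 K)⁰ K} (hI : I ≠ 0) :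
    Submodule.span ℝ (algebraMap K (RealSpace K) '' (I : Set K)) = ⊤ := by
  let b := NumberField.basisOfFractionalIdeal K (Units.mk0 I hI)
  rw [eq_top_iff, ← (realBasis b).span_eq]
  refine Submodule.span_mono ?_
  rintro _ ⟨i, rfl⟩
  rw [realBasis_apply]
  exact ⟨b i, (NumberField.mem_span_basisOfFractionalIdeal K (I := Units.mk0 I hI)).mp
    (Submodule.subset_span ⟨i, rfl⟩), rfl⟩

variable {c : K →+* K} (hc : IsComplexConjugation c)
include hc

theorem mem_dualLattice_integersLattice {x : RealSpace K} :
    x ∈ dualLattice ((integersLattice K).restrictScalars ℤ) ↔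
      ∃ b ∈ codifferent K, algebraMap K (RealSpace K) b = x := by
  have hc_int (a : 𝓞 K) : ∃ a' : 𝓞 K, (a' : K) = c a := ⟨⟨c a, map_isIntegral_int c a.2⟩, rfl⟩
  have hinner (a : K) : inner ℝ x (algebraMap K (RealSpace K) (c a)) =
      realTrace (x * algebraMap K (RealSpace K) a) := by
    rw [← conjIso_algebraMap hc, inner_conjIso_right]
  rw [exists_mem_dual_algebraMap_eq_iff (one_ne_zero' (FractionalIdeal (𝓞 K)⁰ K))]
  constructor
  · intro hx a ha
    obtain ⟨a, rfl⟩ := (mem_one_iff _).mp ha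
    obtain ⟨a', ha'⟩ := hc_int a
    rw [← hinner, ← ha']
    exact hx _ ⟨a', rfl⟩
  · rintro hx _ ⟨a, rfl⟩
    obtain ⟨a', ha'⟩ := hc_int a
    obtain ⟨k, hk⟩ := hx a' ((mem_one_iff _).mpr ⟨a', rfl⟩)
    rw [← hinner, ha', hc.apply_apply] at hk
    exact ⟨k, hk⟩

theorem invMulDual_eq_map (P : Ideal (𝓞 K)) :
    invMulDual P =
      ((P : FractionalIdeal (𝓞 K)⁰ K)⁻¹ * codifferent K).coeToSubmodule.map
        ((Algebra.linearMap K (RealSpace K)).restrictScalars (𝓞 K)) := by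
  rw [FractionalIdeal.coe_mul, Submodule.mul_eq_span_mul_set, Submodule.map_span, invMulDual]
  congr 1
  ext x
  simp only [mem_dualLattice_integersLattice hc, Set.mem_ofPred_eq, Set.mem_image, Set.mem_mul]
  constructor
  · rintro ⟨a, ha, _, ⟨b, hb, rfl⟩, rfl⟩
    exact ⟨a * b, ⟨a, ha, b, hb, rfl⟩, by simp [Algebra.smul_def]⟩
  · rintro ⟨_, ⟨a, ha, b, hb, rfl⟩, rfl⟩
    exact ⟨a, ha, _, ⟨b, hb, rfl⟩, by simp [Algebra.smul_def]⟩

end Duality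
end RealSpace

/-! ## Symplectic duality over Dedekind domains -/

section SymplecticDuality

open FractionalIdeal nonZeroDivisors

/-- The standard symplectic form `x₁ y₂ - x₂ y₁` on the plane `K²`. -/
def symplecticForm (K : Type*) [CommRing K] : LinearMap.BilinForm K (K × K) :=
  (LinearMap.mul K K).compl₁₂ (LinearMap.fst K K K) (LinearMap.snd K K K) -
    (LinearMap.mul K K).compl₁₂ (LinearMap.snd K K K) (LinearMap.fst K K K)

section CommRing

variable {K : Type*} [CommRing K]

theorem symplecticForm_apply (x y : K × K) : symplecticForm K x y = x.1 * y.2 - x.2 * y.1 := rfl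

theorem symplecticForm_self (x : K × K) : symplecticForm K x x = 0 := by
  rw [symplecticForm_apply, mul_comm, sub_self]

theorem symplecticForm_swap (x y : K × K) : symplecticForm K y x = -symplecticForm K x y := by
  simp only [symplecticForm_apply]
  ring

theorem symplecticForm_plucker (u v w : K × K) :
    w = (1 - symplecticForm K v u) • w + symplecticForm K w u • v - symplecticForm K w v • u := by
  ext <;> simp [symplecticForm_apply] <;> ring

end CommRing

variable {R K : Type*} [CommRing R] [Field K] [Algebra R K]

/-- The dual of a submodule `N` of `K²` for the standard symplectic form, relative to a submodule
`D` of `K` that takes the place of the ring of integers. -/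
def symplecticDual (D : Submodule R K) (N : Submodule R (K × K)) : Submodule R (K × K) where
  carrier := {x | ∀ y ∈ N, symplecticForm K x y ∈ D}
  zero_mem' y _ := by simp
  add_mem' {x x'} hx hx' y hy := by
    rw [LinearMap.map_add₂]
    exact D.add_mem (hx y hy) (hx' y hy)
  smul_mem' r x hx y hy := by
    rw [LinearMap.map_smul_of_tower, LinearMap.smul_apply]
    exact D.smul_mem r (hx y hy)

theorem mem_symplecticDual {D : Submodule R K} {N : Submodule R (K × K)} {x : K × K} :
    x ∈ symplecticDual D N ↔ ∀ y ∈ N, symplecticForm K x y ∈ D := Iff.rfl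

/-- The product `I × J` of two fractional ideals, as a submodule of `K²`. -/
abbrev prodModule (I J : FractionalIdeal R⁰ K) : Submodule R (K × K) :=
  I.coeToSubmodule.prod J.coeToSubmodule

theorem coe_coeIdeal_mul (P : Ideal R) (I : FractionalIdeal R⁰ K) :
    ((P : FractionalIdeal R⁰ K) * I).coeToSubmodule = P • I.coeToSubmodule := by
  refine le_antisymm ?_ (Submodule.smul_le.mpr fun p hp a ha => ?_)
  · rw [FractionalIdeal.coe_mul, Submodule.mul_le]
    rintro _ ⟨p, hp, rfl⟩ a ha
    simpa [Algebra.smul_def] using Submodule.smul_mem_smul hp ha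
  · rw [Algebra.smul_def]
    exact mul_mem_mul (mem_coeIdeal_of_mem _ hp) ha

theorem ideal_smul_prodModule (P : Ideal R) (I J : FractionalIdeal R⁰ K) :
    P • prodModule I J =
      prodModule ((P : FractionalIdeal R⁰ K) * I) ((P : FractionalIdeal R⁰ K) * J) := by
  simp only [prodModule, LinearMap.prod_eq_sup_map, coe_coeIdeal_mul, Submodule.smul_sup,
    Submodule.map_smul'']

theorem symplecticForm_mem {D I J I' J' : FractionalIdeal R⁰ K} (h₁ : I * J' ≤ D)
    (h₂ : J * I' ≤ D) {x y : K × K} (hx : x ∈ prodModule I J) (hy : y ∈ prodModule I' J') :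
    symplecticForm K x y ∈ D :=
  D.coeToSubmodule.sub_mem (h₁ (FractionalIdeal.mul_mem_mul hx.1 hy.2))
    (h₂ (FractionalIdeal.mul_mem_mul hx.2 hy.1))

variable [IsDedekindDomain R] [IsFractionRing R K]

theorem symplecticDual_prodModule {D I J : FractionalIdeal R⁰ K} (hI : I ≠ 0) (hJ : J ≠ 0) :
    symplecticDual D.coeToSubmodule (prodModule I J) = prodModule (D / J) (D / I) := by
  ext x
  simp only [mem_symplecticDual, Submodule.mem_prod, FractionalIdeal.mem_coe,
    mem_div_iff_of_ne_zero hI, mem_div_iff_of_ne_zero hJ]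
  constructor
  · refine fun h => ⟨fun b hb => ?_, fun a ha => ?_⟩
    · simpa [symplecticForm_apply] using h (0, b) ⟨I.zero_mem, hb⟩
    · exact D.coeToSubmodule.neg_mem_iff.mp
        (by simpa [symplecticForm_apply, -neg_mem_iff] using h (a, 0) ⟨ha, J.zero_mem⟩)
  · rintro ⟨h₁, h₂⟩ y ⟨hy₁, hy₂⟩
    exact D.coeToSubmodule.sub_mem (h₁ _ hy₂) (h₂ _ hy₁)

theorem exists_mem_inv_one_sub_mul_mem {P : Ideal R} (hP : P.IsMaximal) {I : FractionalIdeal R⁰ K}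
    (hI : I ≠ 0) {a : K} (ha : a ∈ I) (haP : a ∉ (P * I : FractionalIdeal R⁰ K)) :
    ∃ t ∈ I⁻¹, 1 - a * t ∈ (P : FractionalIdeal R⁰ K) := by
  have hle : spanSingleton R⁰ a * I⁻¹ ≤ 1 := by
    rw [← mul_inv_cancel₀ hI]
    exact mul_le_mul_left (spanSingleton_le_iff_mem.mpr ha) I⁻¹
  obtain ⟨A, hA⟩ := le_one_iff_exists_coeIdeal.mp hle
  have hAP : ¬ A ≤ P := by
    intro h
    rw [← coeIdeal_le_coeIdeal K, hA] at h
    refine haP (spanSingleton_le_iff_mem.mp ?_)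
    simpa only [mul_assoc, inv_mul_cancel₀ hI, mul_one] using mul_le_mul_left h I
  have hsup : A ⊔ P = ⊤ := by
    by_contra h
    exact hAP (le_sup_left.trans (hP.eq_of_le h le_sup_right).ge)
  obtain ⟨x, hx, p, hp, hxp⟩ := Submodule.mem_sup.mp (hsup ▸ Submodule.mem_top (x := (1 : R)))
  obtain ⟨t, ht, hxt⟩ := mem_singleton_mul.mp (hA ▸ mem_coeIdeal_of_mem R⁰ hx)
  refine ⟨t, ht, ?_⟩
  rw [← hxt, ← map_one (algebraMap R K), ← hxp, map_add, add_sub_cancel_left]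
  exact mem_coeIdeal_of_mem _ hp

theorem exists_one_sub_symplecticForm_mem {P : Ideal R} (hP : P.IsMaximal)
    {I J : FractionalIdeal R⁰ K} (hI : I ≠ 0) (hJ : J ≠ 0) {v : K × K} (hv : v ∈ prodModule I J)
    (hvP : v ∉ P • prodModule I J) :
    ∃ u ∈ prodModule J⁻¹ I⁻¹, 1 - symplecticForm K v u ∈ (P : FractionalIdeal R⁰ K) := by
  rw [ideal_smul_prodModule, Submodule.mem_prod, not_and_or] at hvP
  rcases hvP with hvP | hvP
  · obtain ⟨t, ht, h⟩ := exists_mem_inv_one_sub_mul_mem hP hI hv.1 hvP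
    exact ⟨(0, t), ⟨J⁻¹.zero_mem, ht⟩, by simpa [symplecticForm_apply] using h⟩
  · obtain ⟨t, ht, h⟩ := exists_mem_inv_one_sub_mul_mem hP hJ hv.2 hvP
    exact ⟨(-t, 0), ⟨neg_mem ht, I⁻¹.zero_mem⟩, by simpa [symplecticForm_apply] using h⟩

theorem symplecticDual_ideal_smul_prodModule {P : Ideal R} (hP : P ≠ ⊥)
    {I J : FractionalIdeal R⁰ K} (hI : I ≠ 0) (hJ : J ≠ 0) :
    symplecticDual ((P : FractionalIdeal R⁰ K) * (I * J)).coeToSubmodule (P • prodModule I J) =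
      prodModule I J := by
  have hP' : (P : FractionalIdeal R⁰ K) ≠ 0 := coeIdeal_ne_zero.mpr hP
  rw [ideal_smul_prodModule, symplecticDual_prodModule (mul_ne_zero hP' hI) (mul_ne_zero hP' hJ)]
  congr 2 <;> field_simp

variable {P : Ideal R} (hP0 : P ≠ ⊥) {I J : FractionalIdeal R⁰ K} (hI : I ≠ 0) (hJ : J ≠ 0)
  {v : K × K} (hv : v ∈ prodModule I J)
include hP0 hI hJ hv

theorem span_singleton_sup_le_symplecticDual :
    Submodule.span R {v} ⊔ P • prodModule I J ≤
      symplecticDual ((P : FractionalIdeal R⁰ K) * (I * J)).coeToSubmodule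
        (Submodule.span R {v} ⊔ P • prodModule I J) := by
  set D : FractionalIdeal R⁰ K := P * (I * J)
  have hMPM : ∀ x ∈ prodModule I J, ∀ y ∈ P • prodModule I J, symplecticForm K x y ∈ D :=
    fun x hx y hy => (symplecticDual_ideal_smul_prodModule hP0 hI hJ).ge hx y hy
  rw [sup_le_iff, Submodule.span_singleton_le_iff_mem]
  refine ⟨fun y hy => ?_, fun x hx y hy => ?_⟩ <;>
    obtain ⟨_, hz, y, hyP, rfl⟩ := Submodule.mem_sup.mp hy <;>
    obtain ⟨r, rfl⟩ := Submodule.mem_span_singleton.mp hz <;>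
    rw [map_add, LinearMap.map_smul_of_tower]
  · rw [symplecticForm_self, smul_zero, zero_add]
    exact hMPM v hv y hyP
  · rw [symplecticForm_swap]
    exact D.coeToSubmodule.add_mem
      (D.coeToSubmodule.smul_mem r (D.coeToSubmodule.neg_mem (hMPM v hv x hx)))
      (hMPM x (Submodule.smul_le_right hx) y hyP)

theorem symplecticDual_span_singleton_sup (hP : P.IsMaximal) (hvP : v ∉ P • prodModule I J) :
    symplecticDual ((P : FractionalIdeal R⁰ K) * (I * J)).coeToSubmodule
        (Submodule.span R {v} ⊔ P • prodModule I J) =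
      Submodule.span R {v} ⊔ P • prodModule I J := by
  refine le_antisymm (fun w hw => ?_) (span_singleton_sup_le_symplecticDual hP0 hI hJ hv)
  set D : FractionalIdeal R⁰ K := P * (I * J) with hD
  have hwM : w ∈ prodModule I J :=
    (symplecticDual_ideal_smul_prodModule hP0 hI hJ).le fun y hy =>
      hw y (Submodule.mem_sup_right hy)
  have hwv : symplecticForm K w v ∈ D :=
    hw v (Submodule.mem_sup_left (Submodule.mem_span_singleton_self v))
  obtain ⟨u, hu, hvu⟩ := exists_one_sub_symplecticForm_mem hP hI hJ hv hvP
  obtain ⟨p, hp, hpvu⟩ := (mem_coeIdeal _).mp hvu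
  obtain ⟨r, hr⟩ := (mem_one_iff _).mp
    (symplecticForm_mem (D := 1) (mul_inv_cancel₀ hI).le (mul_inv_cancel₀ hJ).le hwM hu)
  have hwvu : symplecticForm K w v • u ∈ P • prodModule I J := by
    have hPI : D * J⁻¹ = P * I := by rw [hD]; field_simp
    have hPJ : D * I⁻¹ = P * J := by rw [hD]; field_simp
    rw [ideal_smul_prodModule, ← hPI, ← hPJ]
    exact ⟨FractionalIdeal.mul_mem_mul hwv hu.1, FractionalIdeal.mul_mem_mul hwv hu.2⟩
  rw [symplecticForm_plucker u v w, ← hpvu, ← hr, algebraMap_smul, algebraMap_smul]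
  exact sub_mem (add_mem (Submodule.mem_sup_right (Submodule.smul_mem_smul hp hwM))
    (Submodule.mem_sup_left (Submodule.mem_span_singleton.mpr ⟨r, rfl⟩)))
    (Submodule.mem_sup_right hwvu)

end SymplecticDuality

/-! ## Symplectic lattices in the plane -/

theorem discreteTopology_of_inner_eq_intCast {E : Type*} [NormedAddCommGroup E]
    [InnerProductSpace ℝ E] [FiniteDimensional ℝ E] {Λ : Submodule ℤ E} {M : Set E}
    (hM : Submodule.span ℝ M = ⊤)
    (h : ∀ x ∈ Λ, ∀ y ∈ M, ∃ k : ℤ, inner ℝ x y = k) : DiscreteTopology Λ := by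
  obtain ⟨t, htM, htspan, htli⟩ := exists_linearIndependent ℝ M
  have htop : ⊤ ≤ Submodule.span ℝ (Set.range ((↑) : t → E)) := by
    rw [Subtype.range_coe, htspan, hM]
  let b : Module.Basis t ℝ E := Module.Basis.mk htli htop
  have : Finite t := Module.Finite.finite_basis b
  refine discreteTopology_of_isOpen_singleton_zero ?_
  have hopen : IsOpen {x : Λ | ∀ i : t, |inner ℝ (x : E) (i : E)| < 1} := by
    simp only [Set.ofPred_forall]
    exact isOpen_iInter_of_finite fun i => isOpen_lt (by fun_prop) continuous_const
  convert! hopen using 1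
  ext x
  simp only [Set.mem_singleton_iff, Set.mem_ofPred_eq]
  constructor
  · rintro rfl i
    simp
  · intro hx
    have h0 : ∀ i : t, inner ℝ (x : E) (i : E) = 0 := by
      intro i
      obtain ⟨k, hk⟩ := h x x.2 i (htM i.2)
      have h1 := hx i
      rw [hk] at h1 ⊢
      have h2 : |k| < 1 := by exact_mod_cast h1
      rw [Int.abs_lt_one_iff.mp h2, Int.cast_zero]
    have h1 : innerₗ E (x : E) = 0 := b.ext fun i => by simp [b, h0]
    exact Subtype.ext (inner_self_eq_zero.mp (LinearMap.congr_fun h1 (x : E)))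

section PlaneLattices

open FractionalIdeal nonZeroDivisors RealSpace

variable {K : Type*} [Field K] [NumberField K]

/-- The embedding `(a, b) ↦ (α⁻¹ a, α b)` of `K²` in `E = K_ℝ²`. -/
def planeEmbedding (K : Type*) [Field K] [NumberField K] (α : ℝ) : K × K →ₗ[𝓞 K] RealPlane K :=
  let ι := (Algebra.linearMap K (RealSpace K)).restrictScalars (𝓞 K)
  (WithLp.linearEquiv 2 (𝓞 K) (RealSpace K × RealSpace K)).symm.toLinearMap ∘ₗ
    (α⁻¹ • ι).prodMap (α • ι)

theorem planeEmbedding_apply (α : ℝ) (x : K × K) :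
    planeEmbedding K α x = WithLp.toLp 2 (α⁻¹ • algebraMap K (RealSpace K) x.1,
      α • algebraMap K (RealSpace K) x.2) := rfl

theorem planeEmbedding_injective {α : ℝ} (hα : α ≠ 0) :
    Function.Injective (planeEmbedding K α) := by
  intro x y h
  simp only [planeEmbedding_apply, WithLp.toLp.injEq, Prod.mk.injEq] at h
  exact Prod.ext (algebraMap_injective (smul_right_injective _ (inv_ne_zero hα) h.1))
    (algebraMap_injective (smul_right_injective _ hα h.2))

/-- The image in `E` of a submodule of `K²` under `planeEmbedding`, as a `ℤ`-module. -/
def planeLattice (α : ℝ) (N : Submodule (𝓞 K) (K × K)) : Submodule ℤ (RealPlane K) :=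
  (N.map (planeEmbedding K α)).restrictScalars ℤ

theorem eq_top_of_planeEmbedding_mem {α : ℝ} (hα : α ≠ 0) {A B : Set K}
    (hA : Submodule.span ℝ (algebraMap K (RealSpace K) '' A) = ⊤)
    (hB : Submodule.span ℝ (algebraMap K (RealSpace K) '' B) = ⊤)
    {S : Submodule ℝ (RealPlane K)} (hAS : ∀ a ∈ A, planeEmbedding K α (a, 0) ∈ S)
    (hBS : ∀ b ∈ B, planeEmbedding K α (0, b) ∈ S) : S = ⊤ := by
  let e := (WithLp.linearEquiv 2 ℝ (RealSpace K × RealSpace K)).symm.toLinearMap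
  have h₁ : S.comap (e ∘ₗ LinearMap.inl ℝ (RealSpace K) (RealSpace K)) = ⊤ := by
    rw [eq_top_iff, ← hA, Submodule.span_le]
    rintro _ ⟨a, ha, rfl⟩
    convert! S.smul_mem α (hAS a ha)
    simp [e, planeEmbedding_apply, hα, ← WithLp.toLp_smul]
  have h₂ : S.comap (e ∘ₗ LinearMap.inr ℝ (RealSpace K) (RealSpace K)) = ⊤ := by
    rw [eq_top_iff, ← hB, Submodule.span_le]
    rintro _ ⟨b, hb, rfl⟩
    convert! S.smul_mem α⁻¹ (hBS b hb)
    simp [e, planeEmbedding_apply, hα, ← WithLp.toLp_smul]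
  refine eq_top_iff.mpr fun x _ => ?_
  convert! S.add_mem (h₁.ge (Submodule.mem_top (x := x.fst)))
    (h₂.ge (Submodule.mem_top (x := x.snd)))
  simp [e, ← WithLp.toLp_add]
  rfl

theorem span_planeLattice {α : ℝ} (hα : α ≠ 0) {I J : FractionalIdeal (𝓞 K)⁰ K} (hI : I ≠ 0)
    (hJ : J ≠ 0) {N : Submodule (𝓞 K) (K × K)} (hN : prodModule I J ≤ N) :
    Submodule.span ℝ (planeLattice α N : Set (RealPlane K)) = ⊤ :=
  eq_top_of_planeEmbedding_mem hα (span_image_fractionalIdeal hI) (span_image_fractionalIdeal hJ)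
    (fun a ha => Submodule.subset_span ⟨(a, 0), hN ⟨ha, J.zero_mem⟩, rfl⟩)
    (fun b hb => Submodule.subset_span ⟨(0, b), hN ⟨I.zero_mem, hb⟩, rfl⟩)

variable {c : K →+* K} (hc : IsComplexConjugation c)

/-- The isometry `(x, y) ↦ (-ȳ, x̄)` of `E`. -/
def symplecticRotation : RealPlane K ≃ₗᵢ[ℝ] RealPlane K where
  toFun x := WithLp.toLp 2 (-conjIso hc x.snd, conjIso hc x.fst)
  invFun x := WithLp.toLp 2 (conjIso hc x.snd, -conjIso hc x.fst)
  map_add' x y := by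
    refine WithLp.ofLp_injective 2 (Prod.ext ?_ ?_) <;> simp [add_comm]
  map_smul' r x := by
    refine WithLp.ofLp_injective 2 (Prod.ext ?_ ?_) <;> simp
  left_inv x := by
    refine WithLp.ofLp_injective 2 (Prod.ext ?_ ?_) <;> simp [conjIso_conjIso]
  right_inv x := by
    refine WithLp.ofLp_injective 2 (Prod.ext ?_ ?_) <;> simp [conjIso_conjIso]
  norm_map' x := by
    rw [← sq_eq_sq₀ (norm_nonneg _) (norm_nonneg _), WithLp.prod_norm_sq_eq_of_L2,
      WithLp.prod_norm_sq_eq_of_L2]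
    simp [add_comm]

theorem symplecticRotation_apply (x : RealPlane K) :
    symplecticRotation hc x = WithLp.toLp 2 (-conjIso hc x.snd, conjIso hc x.fst) := rfl

theorem symplecticRotation_symplecticRotation (x : RealPlane K) :
    symplecticRotation hc (symplecticRotation hc x) = -x := by
  refine WithLp.ofLp_injective 2 (Prod.ext ?_ ?_) <;>
    simp [symplecticRotation_apply, conjIso_conjIso]

theorem inner_symplecticRotation (x y : RealPlane K) :
    inner ℝ (symplecticRotation hc x) y = realTrace (x.fst * y.snd - x.snd * y.fst) := by
  rw [WithLp.prod_inner_apply, symplecticRotation_apply, map_sub, ← inner_conjIso_left hc,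
    ← inner_conjIso_left hc, inner_neg_left, neg_add_eq_sub]
  rfl

theorem inner_symplecticRotation_planeEmbedding {α : ℝ} (hα : α ≠ 0) (x y : K × K) :
    inner ℝ (symplecticRotation hc (planeEmbedding K α x)) (planeEmbedding K α y) =
      realTrace (algebraMap K (RealSpace K) (symplecticForm K x y)) := by
  rw [inner_symplecticRotation]
  simp [planeEmbedding_apply, symplecticForm_apply, smul_smul, hα]

theorem mem_symplecticDual_codifferent_iff {α : ℝ} (hα : α ≠ 0)
    {N : Submodule (𝓞 K) (K × K)} {x : K × K} :
    x ∈ symplecticDual (codifferent K).coeToSubmodule N ↔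
      symplecticRotation hc (planeEmbedding K α x) ∈ dualLattice (planeLattice α N) := by
  constructor
  · rintro hx _ ⟨y, hy, rfl⟩
    obtain ⟨k, hk⟩ := mem_codifferent_iff.mp (hx y hy) 1
    exact ⟨k, by rw [inner_symplecticRotation_planeEmbedding hc hα, ← hk, one_smul]⟩
  · refine fun hx y hy => mem_codifferent_iff.mpr fun r => ?_
    obtain ⟨k, hk⟩ := hx (planeEmbedding K α (r • y)) ⟨r • y, N.smul_mem r hy, rfl⟩
    refine ⟨k, ?_⟩
    rw [← hk, inner_symplecticRotation_planeEmbedding hc hα, LinearMap.map_smul_of_tower]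

theorem dualLattice_planeLattice {α : ℝ} (hα : α ≠ 0) {I J : FractionalIdeal (𝓞 K)⁰ K} (hI : I ≠ 0)
    (hJ : J ≠ 0) {N : Submodule (𝓞 K) (K × K)} (hN : prodModule I J ≤ N) :
    symplecticRotation hc ''
        planeLattice α (symplecticDual (codifferent K).coeToSubmodule N) =
      (dualLattice (planeLattice α N) : Set (RealPlane K)) := by
  ext z
  constructor
  · rintro ⟨_, ⟨x, hx, rfl⟩, rfl⟩
    exact (mem_symplecticDual_codifferent_iff hc hα).mp hx
  · intro hz
    obtain ⟨x, rfl⟩ := (symplecticRotation hc).surjective z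
    have hint (y : K × K) (hy : y ∈ prodModule I J) := hz _ ⟨y, hN hy, rfl⟩
    simp only [inner_symplecticRotation] at hint
    obtain ⟨a, -, ha⟩ := (exists_mem_dual_algebraMap_eq_iff hJ
        (x := α • x.fst)).mpr fun b hb => by
      obtain ⟨k, hk⟩ := hint (0, b) ⟨I.zero_mem, hb⟩
      exact ⟨k, by rw [← hk]; simp [planeEmbedding_apply]⟩
    obtain ⟨b, -, hb⟩ := (exists_mem_dual_algebraMap_eq_iff hI
        (x := α⁻¹ • x.snd)).mpr fun a ha => by
      obtain ⟨k, hk⟩ := hint (a, 0) ⟨ha, J.zero_mem⟩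
      exact ⟨-k, by rw [Int.cast_neg, ← hk]; simp [planeEmbedding_apply]⟩
    have hx : planeEmbedding K α (a, b) = x :=
      WithLp.ofLp_injective 2 (by simp [planeEmbedding_apply, ha, hb, hα]; rfl)
    refine ⟨x, ⟨(a, b), ?_, hx⟩, rfl⟩
    exact (mem_symplecticDual_codifferent_iff hc hα).mpr (hx ▸ hz)

include hc

theorem isEuclideanLattice_planeLattice {α : ℝ} (hα : α ≠ 0) {N : Submodule (𝓞 K) (K × K)}
    {I J : FractionalIdeal (𝓞 K)⁰ K} (hI : I ≠ 0) (hJ : J ≠ 0) (hN : prodModule I J ≤ N)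
    {I' J' : FractionalIdeal (𝓞 K)⁰ K} (hI' : I' ≠ 0) (hJ' : J' ≠ 0)
    (hN' : prodModule I' J' ≤ symplecticDual (codifferent K).coeToSubmodule N) :
    IsEuclideanLattice (planeLattice α N) := by
  refine ⟨discreteTopology_of_inner_eq_intCast (M := dualLattice (planeLattice α N)) ?_ ?_,
    span_planeLattice hα hI hJ hN⟩
  · have hσ := span_planeLattice hα hI' hJ' hN'
    rw [← dualLattice_planeLattice hc hα hI hJ hN]
    exact (Submodule.map_span (symplecticRotation hc).toLinearEquiv.toLinearMap _).symm.trans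
      (by rw [hσ, Submodule.map_top, LinearEquiv.range])
  · intro x hx y hy
    obtain ⟨k, hk⟩ := hy x hx
    exact ⟨k, by rw [real_inner_comm, hk]⟩

theorem isSymplecticLattice_planeLattice {α : ℝ} (hα : α ≠ 0) {N : Submodule (𝓞 K) (K × K)}
    {I J : FractionalIdeal (𝓞 K)⁰ K} (hI : I ≠ 0) (hJ : J ≠ 0) (hN : prodModule I J ≤ N)
    (hdual : symplecticDual (codifferent K).coeToSubmodule N = N) :
    IsSymplecticLattice (planeLattice α N) := by
  refine ⟨isEuclideanLattice_planeLattice hc hα hI hJ hN hI hJ (hN.trans hdual.ge),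
    symplecticRotation hc, ?_, symplecticRotation_symplecticRotation hc⟩
  rw [← dualLattice_planeLattice hc hα hI hJ hN, hdual]

theorem baseLattice_eq_map (P : Ideal (𝓞 K)) :
    baseLattice P = (prodModule 1 ((P : FractionalIdeal (𝓞 K)⁰ K)⁻¹ * codifferent K)).map
      (planeEmbedding K (scalingFactor P)) := by
  rw [baseLattice, invMulDual_eq_map hc, integersLattice]
  ext x
  constructor
  · rintro ⟨⟨_, ⟨a, rfl⟩, ha⟩, ⟨_, ⟨b, hb, rfl⟩, hb'⟩⟩
    exact ⟨(a, b), ⟨(mem_one_iff _).mpr ⟨a, rfl⟩, hb⟩, WithLp.ofLp_injective 2 (Prod.ext ha hb')⟩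
  · rintro ⟨⟨a, b⟩, ⟨ha, hb⟩, rfl⟩
    obtain ⟨a, rfl⟩ := (mem_one_iff _).mp ha
    exact ⟨⟨_, ⟨a, rfl⟩, rfl⟩, ⟨_, ⟨b, hb, rfl⟩, rfl⟩⟩

end PlaneLattices

section Lines

variable {R M : Type*} [CommRing R] [AddCommGroup M] [Module R M]

theorem exists_mk_mem_iff_of_finrank_eq_one {P : Ideal R} (hP : P.IsMaximal)
    {C : Submodule (R ⧸ P) (M ⧸ P • (⊤ : Submodule R M))} (hC : Module.finrank (R ⧸ P) C = 1) :
    ∃ v : M, v ∉ P • (⊤ : Submodule R M) ∧ ∀ w : M,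
      (Submodule.Quotient.mk w : M ⧸ P • (⊤ : Submodule R M)) ∈ C ↔
        w ∈ Submodule.span R {v} ⊔ P • (⊤ : Submodule R M) := by
  let _ : Field (R ⧸ P) := Ideal.Quotient.field P
  obtain ⟨⟨v, hvC⟩, hv0, hv⟩ := finrank_eq_one_iff'.mp hC
  obtain ⟨v, rfl⟩ := Submodule.Quotient.mk_surjective _ v
  refine ⟨v, fun h => hv0 (Subtype.ext ((Submodule.Quotient.mk_eq_zero _).mpr h)),
    fun w => ⟨fun h => ?_, fun h => ?_⟩⟩
  · obtain ⟨r, hr⟩ := hv ⟨_, h⟩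
    obtain ⟨r, rfl⟩ := Ideal.Quotient.mk_surjective r
    have hw : w - r • v ∈ P • (⊤ : Submodule R M) := by
      rw [← Submodule.Quotient.mk_eq_zero, Submodule.Quotient.mk_sub, sub_eq_zero]
      exact (congrArg Subtype.val hr).symm
    exact Submodule.mem_sup.mpr
      ⟨_, Submodule.mem_span_singleton.mpr ⟨r, rfl⟩, _, hw, add_sub_cancel _ _⟩
  · obtain ⟨_, hx, y, hy, rfl⟩ := Submodule.mem_sup.mp h
    obtain ⟨r, rfl⟩ := Submodule.mem_span_singleton.mp hx
    rw [Submodule.Quotient.mk_add, (Submodule.Quotient.mk_eq_zero _).mpr hy, add_zero]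
    exact C.smul_mem (Ideal.Quotient.mk P r) hvC

end Lines

section CodeLattices

open FractionalIdeal nonZeroDivisors RealSpace

variable {K : Type*} [Field K] [NumberField K]

theorem finite_quotient {P : Ideal (𝓞 K)} (hP : P ≠ ⊥) : Finite (𝓞 K ⧸ P) :=
  Ideal.finiteQuotientOfFreeOfNeBot P hP

theorem residueCard_pos {P : Ideal (𝓞 K)} (hP : P ≠ ⊥) : 0 < residueCard P :=
  have := finite_quotient hP
  Nat.card_pos

theorem scalingFactor_pos {P : Ideal (𝓞 K)} (hP : P ≠ ⊥) : 0 < scalingFactor P := by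
  have hq : (0 : ℝ) < residueCard P := by exact_mod_cast residueCard_pos hP
  have hd : (0 : ℝ) < |(NumberField.discr K : ℝ)| := by
    exact_mod_cast abs_pos.mpr (NumberField.discr_ne_zero K)
  unfold scalingFactor
  positivity

theorem codifferent_ne_zero : codifferent K ≠ 0 := dual_ne_zero ℤ ℚ one_ne_zero

variable {c : K →+* K} (hc : IsComplexConjugation c) {P : Ideal (𝓞 K)}
include hc

theorem ideal_smul_baseLattice (hP : P ≠ ⊥) :
    P • baseLattice P = (prodModule (P : FractionalIdeal (𝓞 K)⁰ K) (codifferent K)).map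
      (planeEmbedding K (scalingFactor P)) := by
  rw [baseLattice_eq_map hc, ← Submodule.map_smul'', ideal_smul_prodModule, mul_one,
    mul_inv_cancel_left₀ (coeIdeal_ne_zero.mpr hP)]

theorem exists_codeLattice_eq_planeLattice (hP : P.IsMaximal)
    {C : Submodule (𝓞 K ⧸ P) (CodeSpace P)} (hC : Module.finrank (𝓞 K ⧸ P) C = 1) :
    ∃ v ∈ prodModule 1 ((P : FractionalIdeal (𝓞 K)⁰ K)⁻¹ * codifferent K),
      v ∉ P • prodModule 1 ((P : FractionalIdeal (𝓞 K)⁰ K)⁻¹ * codifferent K) ∧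
      codeLattice P C = planeLattice (scalingFactor P) (Submodule.span (𝓞 K) {v} ⊔
        P • prodModule 1 ((P : FractionalIdeal (𝓞 K)⁰ K)⁻¹ * codifferent K)) := by
  set M := prodModule 1 ((P : FractionalIdeal (𝓞 K)⁰ K)⁻¹ * codifferent K)
  have hPM : P • baseLattice P = (P • M).map (planeEmbedding K (scalingFactor P)) := by
    rw [baseLattice_eq_map hc, Submodule.map_smul'']
  obtain ⟨⟨x, hx⟩, hxP, hCx⟩ := exists_mk_mem_iff_of_finrank_eq_one hP hC
  obtain ⟨v, hv, rfl⟩ := (baseLattice_eq_map hc P).le hx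
  have hmap : (Submodule.span (𝓞 K) {⟨planeEmbedding K (scalingFactor P) v, hx⟩} ⊔
        P • (⊤ : Submodule (𝓞 K) (baseLattice P))).map (baseLattice P).subtype =
      (Submodule.span (𝓞 K) {v} ⊔ P • M).map (planeEmbedding K (scalingFactor P)) := by
    rw [Submodule.map_sup, Submodule.map_sup, Submodule.map_smul'', Submodule.map_subtype_top, hPM]
    simp only [Submodule.map_span, Set.image_singleton, Submodule.subtype_apply]
  refine ⟨v, hv, fun h => hxP ?_, Submodule.ext fun y => ?_⟩
  · rw [Submodule.mem_smul_top_iff, hPM]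
    exact ⟨v, h, rfl⟩
  · rw [mem_codeLattice, planeLattice, Submodule.restrictScalars_mem, ← hmap]
    exact ⟨fun ⟨h, hy⟩ => ⟨⟨y, h⟩, (hCx _).mp hy, rfl⟩,
      by rintro ⟨w, hw, rfl⟩; exact ⟨w.2, (hCx _).mpr hw⟩⟩

theorem isSymplecticLattice_of_mem_lineLattices (hP : P.IsPrime) (hP0 : P ≠ ⊥)
    {Λ : Submodule ℤ (RealPlane K)} (hΛ : Λ ∈ lineLattices P) : IsSymplecticLattice Λ := by
  obtain ⟨C, hC, rfl⟩ := hΛ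
  have hP' : (P : FractionalIdeal (𝓞 K)⁰ K) ≠ 0 := coeIdeal_ne_zero.mpr hP0
  have hmax := hP.isMaximal hP0
  obtain ⟨v, hv, hvP, hΛ⟩ := exists_codeLattice_eq_planeLattice hc hmax hC
  rw [hΛ]
  have h := symplecticDual_span_singleton_sup hP0 (one_ne_zero' (FractionalIdeal (𝓞 K)⁰ K))
    (mul_ne_zero (inv_ne_zero hP') codifferent_ne_zero) hv hmax hvP
  rw [one_mul, mul_inv_cancel_left₀ hP'] at h
  refine isSymplecticLattice_planeLattice hc (scalingFactor_pos hP0).ne' hP'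
    codifferent_ne_zero (le_sup_of_le_right ?_) h
  rw [ideal_smul_prodModule, mul_one, mul_inv_cancel_left₀ hP']

end CodeLattices

/-! ## Minima, covolumes and densities -/

section EuclideanLattices

theorem card_le_tsum_indicator_closedBall {E : Type*} [SeminormedAddCommGroup E]
    {Λ : Submodule ℤ E} {ρ r : ℝ} {x : E} {v : Λ}
    (hv : ‖x - v‖ ≤ ρ) {s : Finset Λ} (hs : ∀ w ∈ s, ‖w‖ ≤ r) :
    (s.card : ENNReal) ≤
      ∑' g : Λ, (Metric.closedBall (0 : E) (r + ρ)).indicator 1 (-g +ᵥ x) := by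
  rw [← (Equiv.subLeft v).tsum_eq]
  calc (s.card : ENNReal)
      = ∑ w ∈ s, (Metric.closedBall (0 : E) (r + ρ)).indicator 1 (-(v - w) +ᵥ x) := by
        rw [Finset.cast_card]
        refine Finset.sum_congr rfl fun w hw => ?_
        have hx : -(v - w) +ᵥ x = w + (x - v) := by
          change -((v : E) - w) + x = w + (x - v)
          abel
        rw [hx, Set.indicator_of_mem, Pi.one_apply]
        exact mem_closedBall_zero_iff.mpr ((norm_add_le _ _).trans (add_le_add (hs w hw) hv))
    _ ≤ _ := ENNReal.sum_le_tsum s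

variable {E : Type*} [NormedAddCommGroup E] [InnerProductSpace ℝ E]

section Covolume

variable [FiniteDimensional ℝ E] [MeasurableSpace E] [BorelSpace E]

theorem covolume_span_eq_abs_det {ι : Type*} [Fintype ι] [DecidableEq ι]
    (o : OrthonormalBasis ι ℝ E) (b : Module.Basis ι ℝ E) :
    ZLattice.covolume (Submodule.span ℤ (Set.range b)) = |(o.toBasis.toMatrix b).det| := by
  have hvol : (volume : Measure E).real (ZSpan.fundamentalDomain o.toBasis) = 1 := by
    rw [measureReal_congr (ZSpan.fundamentalDomain_ae_parallelepiped o.toBasis volume),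
      OrthonormalBasis.coe_toBasis, measureReal_def, o.volume_parallelepiped, ENNReal.toReal_one]
  rw [ZLattice.covolume_eq_det_mul_measureReal _ volume (b.restrictScalars ℤ) o.toBasis, hvol,
    mul_one, Module.Basis.det_apply]
  congr with i
  simp

theorem covolume_mul_covolume_dualLattice (Λ : Submodule ℤ E) [DiscreteTopology Λ]
    [IsZLattice ℝ Λ] : ZLattice.covolume Λ * ZLattice.covolume (dualLattice Λ) = 1 := by
  classical
  have := ZLattice.module_free ℝ Λ
  have := ZLattice.module_finite ℝ Λ
  obtain ⟨ι, _, b, rfl⟩ : ∃ (ι : Type _) (_ : Fintype ι) (b : Module.Basis ι ℝ E),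
      Submodule.span ℤ (Set.range b) = Λ :=
    ⟨_, inferInstance, _, (Module.Free.chooseBasis ℤ Λ).ofZLatticeBasis_span ℝ⟩
  let o := (stdOrthonormalBasis ℝ E).reindex ((Module.finBasis ℝ E).indexEquiv b)
  have hB : (innerₗ E).Nondegenerate :=
    ⟨fun x hx => inner_self_eq_zero.mp (hx x), fun x hx => inner_self_eq_zero.mp (hx x)⟩
  let b' := LinearMap.BilinForm.dualBasis (innerₗ E) hB b
  have hdual : dualLattice (Submodule.span ℤ (Set.range b)) = Submodule.span ℤ (Set.range b') := by
    rw [← LinearMap.BilinForm.dualSubmodule_span_of_basis]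
    ext x
    simp [dualLattice, LinearMap.BilinForm.mem_dualSubmodule, Submodule.mem_one, eq_comm]
  have hgram : (o.toBasis.toMatrix b').transpose * o.toBasis.toMatrix b = 1 := by
    ext i j
    have hij : inner ℝ (b' i) (b j) = if j = i then 1 else 0 :=
      LinearMap.BilinForm.apply_dualBasis_left hB b i j
    rw [← o.sum_inner_mul_inner] at hij
    simpa [Matrix.mul_apply, Module.Basis.toMatrix_apply, Matrix.one_apply,
      OrthonormalBasis.repr_apply_apply, real_inner_comm, eq_comm] using hij
  rw [hdual, covolume_span_eq_abs_det o, covolume_span_eq_abs_det o, ← abs_mul, mul_comm,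
    ← Matrix.det_transpose, ← Matrix.det_mul, hgram, Matrix.det_one, abs_one]

theorem covolume_eq_one_of_isSymplecticLattice {Λ : Submodule ℤ E} (hΛ : IsSymplecticLattice Λ) :
    ZLattice.covolume Λ = 1 := by
  obtain ⟨⟨_, hspan⟩, σ, hσ, -⟩ := hΛ
  have : IsZLattice ℝ Λ := ⟨hspan⟩
  have hdual : dualLattice Λ = ZLattice.comap ℝ Λ σ.symm.toContinuousLinearEquiv.toLinearMap := by
    refine SetLike.coe_injective ?_
    rw [← hσ]
    exact σ.toEquiv.image_eq_preimage_symm _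
  have hsq := covolume_mul_covolume_dualLattice Λ
  rw [hdual, ZLattice.covolume_comap Λ volume volume σ.symm.measurePreserving] at hsq
  nlinarith [ZLattice.covolume_pos Λ]

theorem card_mul_covolume_le {Λ : Submodule ℤ E} [DiscreteTopology Λ] [IsZLattice ℝ Λ] {ρ r : ℝ}
    (hρ : ∀ x : E, ∃ v ∈ Λ, ‖x - v‖ ≤ ρ) {s : Finset Λ} (hs : ∀ w ∈ s, ‖w‖ ≤ r) :
    s.card * ZLattice.covolume Λ ≤ (volume : Measure E).real (Metric.closedBall 0 (r + ρ)) := by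
  have := ZLattice.module_free ℝ Λ
  have := ZLattice.module_finite ℝ Λ
  have : VAddInvariantMeasure Λ E volume :=
    (inferInstance : VAddInvariantMeasure Λ.toAddSubgroup E volume)
  have : MeasurableVAdd Λ E := (inferInstance : MeasurableVAdd Λ.toAddSubgroup E)
  let F := ZSpan.fundamentalDomain ((Module.Free.chooseBasis ℤ Λ).ofZLatticeBasis ℝ Λ)
  have hF : IsAddFundamentalDomain Λ F volume :=
    ZLattice.isAddFundamentalDomain (Module.Free.chooseBasis ℤ Λ) volume
  let B : Set E := Metric.closedBall 0 (r + ρ)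
  have hB : MeasurableSet B := Metric.isClosed_closedBall.measurableSet
  have hle : (s.card : ENNReal) * volume F ≤ volume B := by
    calc (s.card : ENNReal) * volume F = ∫⁻ _ in F, s.card := by rw [setLIntegral_const]
      _ ≤ ∫⁻ x in F, ∑' g : Λ, B.indicator 1 (-g +ᵥ x) := by
          refine lintegral_mono fun x => ?_
          obtain ⟨v, hv, hxv⟩ := hρ x
          exact card_le_tsum_indicator_closedBall (v := ⟨v, hv⟩) hxv hs
      _ = ∑' g : Λ, ∫⁻ x in F, B.indicator 1 (-g +ᵥ x) := by
          refine lintegral_tsum fun g => ?_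
          exact ((measurable_one.indicator hB).comp (measurable_const_vadd (-g))).aemeasurable
      _ = ∫⁻ x, B.indicator 1 x := (hF.lintegral_eq_tsum' _).symm
      _ = volume B := lintegral_indicator_one hB
  rw [ZLattice.covolume_eq_measure_fundamentalDomain Λ volume hF]
  simpa [measureReal_def] using
    ENNReal.toReal_mono Metric.isBounded_closedBall.measure_lt_top.ne hle

end Covolume

theorem exists_int_norm_sub_smul_add_sq_le (t : ℝ) (u v : E) :
    ∃ n : ℤ, ‖(t - n) • v + u‖ ^ 2 ≤ ‖u‖ ^ 2 + ‖v‖ ^ 2 / 4 := by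
  have hexpand (a : ℝ) : ‖a • v + u‖ ^ 2 = a ^ 2 * ‖v‖ ^ 2 + 2 * a * inner ℝ v u + ‖u‖ ^ 2 := by
    rw [norm_add_sq_real, norm_smul, real_inner_smul_left, mul_pow, Real.norm_eq_abs, sq_abs]
    ring
  -- The two residues `a` and `a - 1`, weighted by `1 - a` and `a`, average to at most the bound.
  set a := Int.fract t
  by_contra! h
  have h₀ := h ⌊t⌋
  have h₁ := h (⌊t⌋ + 1)
  rw [Int.cast_add, Int.cast_one, ← sub_sub] at h₁
  rw [Int.self_sub_floor, hexpand] at h₀ h₁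
  nlinarith [mul_nonneg (sq_nonneg ‖v‖) (sq_nonneg (a - 1 / 2)),
    mul_le_mul_of_nonneg_left h₁.le (Int.fract_nonneg t),
    mul_lt_mul_of_pos_left h₀ (sub_pos.mpr (Int.fract_lt_one t))]

theorem exists_int_norm_sum_sq_le {ι : Type*} (s : Finset ι) (v : ι → E) (t : ι → ℝ) :
    ∃ n : ι → ℤ, ‖∑ i ∈ s, (t i - n i) • v i‖ ^ 2 ≤ (∑ i ∈ s, ‖v i‖ ^ 2) / 4 := by
  classical
  induction s using Finset.induction_on with
  | empty => exact ⟨0, by simp⟩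
  | insert j s hj ih =>
    obtain ⟨n, hn⟩ := ih
    obtain ⟨k, hk⟩ :=
      exists_int_norm_sub_smul_add_sq_le (t j) (∑ i ∈ s, (t i - n i) • v i) (v j)
    refine ⟨Function.update n j k, ?_⟩
    have hupdate : ∑ i ∈ s, (t i - (Function.update n j k i : ℤ)) • v i =
        ∑ i ∈ s, (t i - n i) • v i :=
      Finset.sum_congr rfl fun i hi => by
        rw [Function.update_of_ne (ne_of_mem_of_not_mem hi hj)]
    rw [Finset.sum_insert hj, Finset.sum_insert hj, Function.update_self, hupdate]
    linarith

theorem exists_mem_norm_sub_le {ι : Type*} [Fintype ι] {Λ : Submodule ℤ E} {v : ι → E}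
    (hv : ∀ i, v i ∈ Λ) (hspan : Submodule.span ℝ (Set.range v) = ⊤) {ρ : ℝ} (hρ₀ : 0 ≤ ρ)
    (hρ : (∑ i, ‖v i‖ ^ 2) / 4 ≤ ρ ^ 2) (x : E) : ∃ w ∈ Λ, ‖x - w‖ ≤ ρ := by
  obtain ⟨t, rfl⟩ := (Submodule.mem_span_range_iff_exists_fun ℝ).mp
    (hspan ▸ Submodule.mem_top : x ∈ Submodule.span ℝ (Set.range v))
  obtain ⟨n, hn⟩ := exists_int_norm_sum_sq_le Finset.univ v t
  refine ⟨∑ i, n i • v i, Submodule.sum_mem _ fun i _ => Λ.smul_mem _ (hv i), ?_⟩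
  have hsub : ∑ i, t i • v i - ∑ i, n i • v i = ∑ i, (t i - n i) • v i := by
    simp only [sub_smul, Int.cast_smul_eq_zsmul, Finset.sum_sub_distrib]
  rw [hsub]
  exact (abs_le_of_sq_le_sq' (hn.trans hρ) hρ₀).2

theorem IsEuclideanLattice.exists_ne_zero [Nontrivial E] {Λ : Submodule ℤ E}
    (hΛ : IsEuclideanLattice Λ) : ∃ v ∈ Λ, v ≠ 0 := by
  by_contra! h
  have hbot : Λ = ⊥ := Λ.eq_bot_iff.mpr h
  have hspan := hΛ.2
  rw [hbot, Submodule.bot_coe, Submodule.span_zero_singleton] at hspan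
  exact bot_ne_top hspan

theorem le_latticeDensity [FiniteDimensional ℝ E] [Nontrivial E] [MeasurableSpace E]
    [BorelSpace E] {Λ : Submodule ℤ E} (hΛ : IsEuclideanLattice Λ) {r : ℝ}
    (hr : ∀ v ∈ Λ, v ≠ 0 → r ≤ ‖v‖) :
    (volume : Measure E).real (Metric.closedBall 0 r) /
      (2 ^ Module.finrank ℝ E * ZLattice.covolume Λ) ≤ latticeDensity Λ := by
  have hmin : r ≤ latticeMinimum Λ := by
    obtain ⟨v, hv, hv₀⟩ := hΛ.exists_ne_zero
    refine le_csInf ⟨‖v‖, v, hv, hv₀, rfl⟩ ?_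
    rintro _ ⟨w, hw, hw₀, rfl⟩
    exact hr w hw hw₀
  have hcovol : 0 ≤ ZLattice.covolume Λ := ENNReal.toReal_nonneg
  exact div_le_div_of_nonneg_right
    (measureReal_mono (Metric.closedBall_subset_closedBall hmin)
      Metric.isBounded_closedBall.measure_lt_top.ne) (by positivity)

theorem volume_real_closedBall_of_finrank_eq_two_mul [FiniteDimensional ℝ E] [Nontrivial E]
    [MeasurableSpace E] [BorelSpace E] {n : ℕ} (hn : Module.finrank ℝ E = 2 * n) (x : E) {r : ℝ}
    (hr : 0 ≤ r) : (volume : Measure E).real (Metric.closedBall x r) =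
      r ^ (2 * n) * (Real.pi ^ n / n.factorial) := by
  rw [measureReal_def, InnerProductSpace.volume_closedBall_of_dim_even hn, ENNReal.toReal_mul,
    ENNReal.toReal_pow, ENNReal.toReal_ofReal hr, ENNReal.toReal_ofReal (by positivity), hn]

end EuclideanLattices

theorem finrank_realPlane (K : Type*) [Field K] [NumberField K] :
    Module.finrank ℝ (RealPlane K) = 2 * Module.finrank ℚ K := by
  rw [(WithLp.linearEquiv 2 ℝ (RealSpace K × RealSpace K)).finrank_eq, Module.finrank_prod,
    RealSpace.finrank_eq, two_mul]

/-! ## Short vectors and covering -/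

section NormEstimates

open FractionalIdeal nonZeroDivisors RealSpace Module

variable {K : Type*} [Field K] [NumberField K]

/-- The normalized norm `N(I) ^ (1 / [K : ℚ])` of a fractional ideal `I`: the scale that `I` has as
a lattice of `K_ℝ`, in the same way as `NumberField.rootDiscr` normalizes the discriminant. -/
def rootNorm (I : FractionalIdeal (𝓞 K)⁰ K) : ℝ := (absNorm I : ℝ) ^ (finrank ℚ K : ℝ)⁻¹

theorem rootNorm_mul (I J : FractionalIdeal (𝓞 K)⁰ K) :
    rootNorm (I * J) = rootNorm I * rootNorm J := by
  rw [rootNorm, map_mul, Rat.cast_mul, Real.mul_rpow (by exact_mod_cast absNorm_nonneg I)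
    (by exact_mod_cast absNorm_nonneg J), rootNorm, rootNorm]

theorem rootNorm_one : rootNorm (1 : FractionalIdeal (𝓞 K)⁰ K) = 1 := by
  rw [rootNorm, map_one, Rat.cast_one, Real.one_rpow]

theorem rootNorm_inv (I : FractionalIdeal (𝓞 K)⁰ K) : rootNorm I⁻¹ = (rootNorm I)⁻¹ := by
  rw [rootNorm, map_inv₀, Rat.cast_inv, Real.inv_rpow (by exact_mod_cast absNorm_nonneg I),
    rootNorm]

theorem absNorm_pos {I : FractionalIdeal (𝓞 K)⁰ K} (hI : I ≠ 0) : 0 < absNorm I :=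
  (absNorm_nonneg I).lt_of_ne' (absNorm_eq_zero_iff.not.mpr hI)

theorem rootNorm_pos {I : FractionalIdeal (𝓞 K)⁰ K} (hI : I ≠ 0) : 0 < rootNorm I :=
  Real.rpow_pos_of_pos (by exact_mod_cast absNorm_pos hI) _

theorem rootNorm_coeIdeal (P : Ideal (𝓞 K)) :
    rootNorm (P : FractionalIdeal (𝓞 K)⁰ K) = (residueCard P : ℝ) ^ (finrank ℚ K : ℝ)⁻¹ := by
  rw [rootNorm, coeIdeal_absNorm, Ideal.absNorm_apply, Submodule.cardQuot_apply, Rat.cast_natCast,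
    residueCard]

theorem rootDiscr_pos : 0 < NumberField.rootDiscr K :=
  Real.rpow_pos_of_pos (by simp [NumberField.discr_ne_zero K]) _

theorem rootNorm_codifferent : rootNorm (codifferent K) = (NumberField.rootDiscr K)⁻¹ := by
  have h := congrArg absNorm (coeIdeal_differentIdeal ℤ ℚ K (𝓞 K))
  rw [coeIdeal_absNorm, map_inv₀, NumberField.absNorm_differentIdeal (K := K)] at h
  rw [rootNorm, ← inv_inv (absNorm (codifferent K)), ← h, Nat.cast_natAbs, Int.cast_abs,
    Rat.cast_inv, Rat.cast_abs, Rat.cast_intCast, Real.inv_rpow (abs_nonneg _),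
    NumberField.rootDiscr_def, Int.cast_abs]

theorem scalingFactor_sq (P : Ideal (𝓞 K)) : scalingFactor P ^ 2 =
    rootNorm (P : FractionalIdeal (𝓞 K)⁰ K) * NumberField.rootDiscr K := by
  rw [rootNorm_coeIdeal, NumberField.rootDiscr_def, Int.cast_abs,
    ← Real.mul_rpow (Nat.cast_nonneg _) (abs_nonneg _), scalingFactor, ← Real.rpow_natCast,
    ← Real.rpow_mul (by positivity)]
  congr 1
  push_cast
  field_simp

section LowerBounds

theorem finrank_mul_rpow_norm_sq_le (x : K) :
    finrank ℚ K * (|((Algebra.norm ℚ x : ℚ) : ℝ)| ^ (finrank ℚ K : ℝ)⁻¹) ^ 2 ≤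
      ‖algebraMap K (RealSpace K) x‖ ^ 2 := by
  have hn : (0 : ℝ) < finrank ℚ K := by exact_mod_cast finrank_pos
  have hprod : ∏ τ : K →+* ℂ, ‖τ x‖ = |((Algebra.norm ℚ x : ℚ) : ℝ)| := by
    rw [← Complex.norm_ratCast, ← eq_ratCast (algebraMap ℚ ℂ), Algebra.norm_eq_prod_embeddings,
      norm_prod]
    exact Fintype.prod_equiv (RingHom.equivRatAlgHom K ℂ) _ _ fun τ => rfl
  have amgm := Real.geom_mean_le_arith_mean Finset.univ (fun _ : K →+* ℂ => 1)
    (fun τ => ‖τ x‖ ^ 2) (fun _ _ => zero_le_one) (by simp [Fintype.card_pos])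
    (fun _ _ => sq_nonneg _)
  simp only [Real.rpow_one, Finset.sum_const, Finset.card_univ, nsmul_eq_mul, mul_one, one_mul,
    NumberField.Embeddings.card] at amgm
  rw [Finset.prod_pow, hprod, ← Real.rpow_pow_comm (abs_nonneg _), le_div_iff₀ hn] at amgm
  rw [norm_sq, mul_comm]
  simpa only [embed_algebraMap] using amgm

theorem absNorm_le_abs_norm {I : FractionalIdeal (𝓞 K)⁰ K} {x : K} (hx : x ∈ I) (hx0 : x ≠ 0) :
    absNorm I ≤ |Algebra.norm ℚ x| := by
  have hI : I ≠ 0 := by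
    rintro rfl
    exact hx0 ((mem_zero_iff _).mp hx)
  have hle : spanSingleton (𝓞 K)⁰ x * I⁻¹ ≤ 1 := by
    rw [← mul_inv_cancel₀ hI]
    exact mul_le_mul_left (spanSingleton_le_iff_mem.mpr hx) _
  obtain ⟨J, hJ⟩ := le_one_iff_exists_coeIdeal.mp hle
  have hJI : (J : FractionalIdeal (𝓞 K)⁰ K) * I = spanSingleton (𝓞 K)⁰ x := by
    rw [hJ, inv_mul_cancel_right₀ hI]
  have hJ0 : J ≠ ⊥ := by
    rintro rfl
    rw [coeIdeal_bot, zero_mul, eq_comm, spanSingleton_eq_zero_iff] at hJI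
    exact hx0 hJI
  rw [← absNorm_span_singleton (R := 𝓞 K), ← hJI, map_mul, coeIdeal_absNorm]
  have hJ1 : 1 ≤ Ideal.absNorm J :=
    Nat.one_le_iff_ne_zero.mpr (Ideal.absNorm_eq_zero_iff.not.mpr hJ0)
  exact le_mul_of_one_le_left (absNorm_nonneg I) (by exact_mod_cast hJ1)

theorem finrank_mul_rootNorm_sq_le {I : FractionalIdeal (𝓞 K)⁰ K} {x : K} (hx : x ∈ I)
    (hx0 : x ≠ 0) : finrank ℚ K * rootNorm I ^ 2 ≤ ‖algebraMap K (RealSpace K) x‖ ^ 2 := by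
  have hle : (absNorm I : ℝ) ≤ |((Algebra.norm ℚ x : ℚ) : ℝ)| := by
    exact_mod_cast absNorm_le_abs_norm hx hx0
  have hI : (0 : ℝ) ≤ absNorm I := by exact_mod_cast absNorm_nonneg I
  refine le_trans ?_ (finrank_mul_rpow_norm_sq_le x)
  rw [rootNorm]
  gcongr

theorem norm_planeEmbedding_sq (α : ℝ) (x : K × K) :
    ‖planeEmbedding K α x‖ ^ 2 = (α ^ 2)⁻¹ * ‖algebraMap K (RealSpace K) x.1‖ ^ 2 +
      α ^ 2 * ‖algebraMap K (RealSpace K) x.2‖ ^ 2 := by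
  rw [WithLp.prod_norm_sq_eq_of_L2, planeEmbedding_apply, WithLp.toLp_fst, WithLp.toLp_snd,
    norm_smul, norm_smul, mul_pow, mul_pow, norm_inv, Real.norm_eq_abs, inv_pow, sq_abs]

theorem le_norm_planeEmbedding_sq {α t : ℝ} {I J : FractionalIdeal (𝓞 K)⁰ K}
    (hI : t ≤ (α ^ 2)⁻¹ * rootNorm I ^ 2) (hJ : t ≤ α ^ 2 * rootNorm J ^ 2) {x : K × K}
    (hx : x ∈ prodModule I J) (hx0 : x ≠ 0) :
    finrank ℚ K * t ≤ ‖planeEmbedding K α x‖ ^ 2 := by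
  rw [norm_planeEmbedding_sq]
  by_cases h : x.1 = 0
  · have h2 : x.2 ≠ 0 := fun h2 => hx0 (Prod.ext h h2)
    calc finrank ℚ K * t ≤ finrank ℚ K * (α ^ 2 * rootNorm J ^ 2) := by gcongr
      _ = α ^ 2 * (finrank ℚ K * rootNorm J ^ 2) := by ring
      _ ≤ α ^ 2 * ‖algebraMap K (RealSpace K) x.2‖ ^ 2 := by
        gcongr
        exact finrank_mul_rootNorm_sq_le hx.2 h2
      _ ≤ _ := le_add_of_nonneg_left (by positivity)
  · calc finrank ℚ K * t ≤ finrank ℚ K * ((α ^ 2)⁻¹ * rootNorm I ^ 2) := by gcongr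
      _ = (α ^ 2)⁻¹ * (finrank ℚ K * rootNorm I ^ 2) := by ring
      _ ≤ (α ^ 2)⁻¹ * ‖algebraMap K (RealSpace K) x.1‖ ^ 2 := by
        gcongr
        exact finrank_mul_rootNorm_sq_le hx.1 h
      _ ≤ _ := le_add_of_nonneg_right (by positivity)

theorem le_norm_sq_of_mem_ideal_smul_baseLattice {c : K →+* K} (hc : IsComplexConjugation c)
    {P : Ideal (𝓞 K)} (hP : P ≠ ⊥) {v : RealPlane K} (hv : v ∈ P • baseLattice P) (hv0 : v ≠ 0) :
    finrank ℚ K * (rootNorm (P : FractionalIdeal (𝓞 K)⁰ K) / NumberField.rootDiscr K) ≤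
      ‖v‖ ^ 2 := by
  rw [ideal_smul_baseLattice hc hP] at hv
  obtain ⟨x, hx, rfl⟩ := hv
  have hN := rootNorm_pos (coeIdeal_ne_zero.mpr hP : (P : FractionalIdeal (𝓞 K)⁰ K) ≠ 0)
  have hd := rootDiscr_pos (K := K)
  refine le_norm_planeEmbedding_sq (le_of_eq ?_) (le_of_eq ?_) hx fun h => hv0 (by rw [h, map_zero])
  · rw [scalingFactor_sq]
    field_simp
  · rw [scalingFactor_sq, rootNorm_codifferent]
    field_simp

end LowerBounds

section Covering

theorem minkowskiBound_le (I : (FractionalIdeal (𝓞 K)⁰ K)ˣ) :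
    NumberField.mixedEmbedding.minkowskiBound K I ≤ ENNReal.ofReal
      (2 ^ finrank ℚ K * (absNorm (I : FractionalIdeal (𝓞 K)⁰ K) *
        √|(NumberField.discr K : ℝ)|)) := by
  have hsqrt : ((NNReal.sqrt ‖NumberField.discr K‖₊ : NNReal) : ENNReal) =
      ENNReal.ofReal √|(NumberField.discr K : ℝ)| := by
    rw [Real.sqrt, ENNReal.ofReal_coe_nnreal]
    congr 2
    ext
    rw [Real.coe_toNNReal _ (abs_nonneg _), coe_nnnorm, Int.norm_eq_abs]
  have hle : (2⁻¹ : ENNReal) ^ NumberField.InfinitePlace.nrComplexPlaces K ≤ 1 :=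
    pow_le_one' (ENNReal.inv_le_one.mpr one_le_two) _
  rw [NumberField.mixedEmbedding.minkowskiBound,
    NumberField.mixedEmbedding.volume_fundamentalDomain_fractionalIdealLatticeBasis,
    NumberField.mixedEmbedding.volume_fundamentalDomain_latticeBasis,
    NumberField.mixedEmbedding.finrank, hsqrt, mul_comm, ENNReal.ofReal_mul (by positivity),
    ENNReal.ofReal_mul (by exact_mod_cast absNorm_nonneg _), ENNReal.ofReal_pow zero_le_two,
    ENNReal.ofReal_ofNat]
  gcongr
  exact mul_le_of_le_one_left' hle

open scoped Classical in
theorem ofReal_pow_le_volume_convexBodyLT (y : NNReal) :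
    ENNReal.ofReal (y ^ finrank ℚ K) ≤
      volume (NumberField.mixedEmbedding.convexBodyLT K fun _ => y) := by
  rw [NumberField.mixedEmbedding.convexBodyLT_volume, Finset.prod_pow_eq_pow_sum,
    NumberField.InfinitePlace.sum_mult_eq, ENNReal.ofReal_pow y.coe_nonneg,
    ENNReal.ofReal_coe_nnreal, ENNReal.coe_pow]
  exact le_mul_of_one_le_left' (by
    exact_mod_cast NumberField.mixedEmbedding.one_le_convexBodyLTFactor K)

theorem exists_ne_zero_mem_forall_norm_le {I : FractionalIdeal (𝓞 K)⁰ K} (hI : I ≠ 0) :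
    ∃ a ∈ I, a ≠ 0 ∧
      ∀ τ : K →+* ℂ, ‖τ a‖ ≤ 3 * (rootNorm I * √(NumberField.rootDiscr K)) := by
  classical
  have hn : finrank ℚ K ≠ 0 := finrank_pos.ne'
  have hN := rootNorm_pos hI
  have hd := rootDiscr_pos (K := K)
  have hpow : (rootNorm I * √(NumberField.rootDiscr K)) ^ finrank ℚ K =
      absNorm I * √|(NumberField.discr K : ℝ)| := by
    rw [mul_pow, rootNorm, Real.rpow_inv_natCast_pow (by exact_mod_cast absNorm_nonneg I) hn,
      Real.sqrt_eq_rpow, Real.rpow_pow_comm hd.le, NumberField.rootDiscr_def, Int.cast_abs,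
      Real.rpow_inv_natCast_pow (abs_nonneg _) hn, Real.sqrt_eq_rpow]
  have hy : 0 < 3 * (rootNorm I * √(NumberField.rootDiscr K)) := by positivity
  let y : NNReal := ⟨_, hy.le⟩
  have hlt : NumberField.mixedEmbedding.minkowskiBound K (Units.mk0 I hI) <
      volume (NumberField.mixedEmbedding.convexBodyLT K fun _ => y) := by
    refine (minkowskiBound_le _).trans_lt (lt_of_lt_of_le ?_ (ofReal_pow_le_volume_convexBodyLT y))
    refine (ENNReal.ofReal_lt_ofReal_iff (pow_pos hy _)).mpr ?_
    rw [Units.val_mk0, ← hpow, ← mul_pow]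
    gcongr
    norm_num
  obtain ⟨a, ha, ha0, h⟩ := NumberField.mixedEmbedding.exists_ne_zero_mem_ideal_lt K _ hlt
  exact ⟨a, ha, ha0, fun τ => (h (NumberField.InfinitePlace.mk τ)).le⟩

variable {ι : Type*} {b : Basis ι ℚ K} (hb : ∀ i, IsIntegral ℤ (b i))
  (hb1 : ∀ i (τ : K →+* ℂ), ‖τ (b i)‖ ≤ 1)
include hb hb1

theorem exists_basis_forall_norm_sq_le {I : FractionalIdeal (𝓞 K)⁰ K} (hI : I ≠ 0) :
    ∃ b' : Basis ι ℚ K, ∀ i, b' i ∈ I ∧ ‖algebraMap K (RealSpace K) (b' i)‖ ^ 2 ≤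
      9 * finrank ℚ K * rootNorm I ^ 2 * NumberField.rootDiscr K := by
  obtain ⟨a, ha, ha0, hle⟩ := exists_ne_zero_mem_forall_norm_le hI
  refine ⟨b.map (DistribMulAction.toLinearEquiv ℚ K (Units.mk0 a ha0)), fun i => ?_⟩
  have happly : b.map (DistribMulAction.toLinearEquiv ℚ K (Units.mk0 a ha0)) i = b i * a :=
    mul_comm a (b i)
  rw [happly]
  constructor
  · exact I.coeToSubmodule.smul_mem (⟨b i, hb i⟩ : 𝓞 K) ha
  · calc ‖algebraMap K (RealSpace K) (b i * a)‖ ^ 2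
        = ∑ τ : K →+* ℂ, (‖τ (b i)‖ * ‖τ a‖) ^ 2 := by
          simp only [norm_sq, embed_algebraMap, map_mul, norm_mul]
      _ ≤ ∑ _τ : K →+* ℂ, (1 * (3 * (rootNorm I * √(NumberField.rootDiscr K)))) ^ 2 := by
          gcongr with τ
          exacts [hb1 i τ, hle τ]
      _ = 9 * finrank ℚ K * rootNorm I ^ 2 * √(NumberField.rootDiscr K) ^ 2 := by
          rw [Finset.sum_const, Finset.card_univ, NumberField.Embeddings.card, nsmul_eq_mul]
          ring
      _ = _ := by rw [Real.sq_sqrt rootDiscr_pos.le]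

theorem exists_mem_planeLattice_norm_sub_le {α : ℝ} (hα : α ≠ 0)
    {I J : FractionalIdeal (𝓞 K)⁰ K} (hI : I ≠ 0) (hJ : J ≠ 0) {N : Submodule (𝓞 K) (K × K)}
    (hN : prodModule I J ≤ N) {ρ : ℝ} (hρ₀ : 0 ≤ ρ)
    (hρ : 9 / 4 * finrank ℚ K ^ 2 * NumberField.rootDiscr K *
      ((α ^ 2)⁻¹ * rootNorm I ^ 2 + α ^ 2 * rootNorm J ^ 2) ≤ ρ ^ 2) (x : RealPlane K) :
    ∃ w ∈ planeLattice α N, ‖x - w‖ ≤ ρ := by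
  have := FiniteDimensional.fintypeBasisIndex b
  obtain ⟨u, hu⟩ := exists_basis_forall_norm_sq_le hb hb1 hI
  obtain ⟨v, hv⟩ := exists_basis_forall_norm_sq_le hb hb1 hJ
  have hspan (b : Basis ι ℚ K) :
      Submodule.span ℝ (algebraMap K (RealSpace K) '' Set.range b) = ⊤ := by
    rw [← Set.range_comp, ← (realBasis b).span_eq]
    simp only [Function.comp_def, ← realBasis_apply]
  let w : ι ⊕ ι → RealPlane K :=
    Sum.elim (fun i => planeEmbedding K α (u i, 0)) fun i => planeEmbedding K α (0, v i)
  have hw : ∀ i, w i ∈ planeLattice α N := by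
    rintro (i | i)
    · exact ⟨_, hN ⟨(hu i).1, J.zero_mem⟩, rfl⟩
    · exact ⟨_, hN ⟨I.zero_mem, (hv i).1⟩, rfl⟩
  refine exists_mem_norm_sub_le hw ?_ hρ₀ (le_trans ?_ hρ) x
  · refine eq_top_of_planeEmbedding_mem hα (hspan u) (hspan v) ?_ ?_
    · rintro _ ⟨i, rfl⟩
      exact Submodule.subset_span ⟨Sum.inl i, rfl⟩
    · rintro _ ⟨i, rfl⟩
      exact Submodule.subset_span ⟨Sum.inr i, rfl⟩
  · simp only [w, Fintype.sum_sum_type, Sum.elim_inl, Sum.elim_inr, norm_planeEmbedding_sq,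
      map_zero, norm_zero, ne_eq, OfNat.ofNat_ne_zero, not_false_eq_true, zero_pow, mul_zero,
      add_zero, zero_add]
    calc _ ≤ (∑ _i : ι, (α ^ 2)⁻¹ *
            (9 * finrank ℚ K * rootNorm I ^ 2 * NumberField.rootDiscr K) +
          ∑ _i : ι, α ^ 2 * (9 * finrank ℚ K * rootNorm J ^ 2 * NumberField.rootDiscr K)) / 4 := by
          gcongr with i _ i _
          exacts [(hu i).2, (hv i).2]
      _ = _ := by
          rw [Finset.sum_const, Finset.sum_const, Finset.card_univ, ← finrank_eq_card_basis b,
            nsmul_eq_mul, nsmul_eq_mul]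
          ring

theorem exists_mem_baseLattice_norm_sub_le {c : K →+* K} (hc : IsComplexConjugation c)
    {P : Ideal (𝓞 K)} (hP : P ≠ ⊥) {ρ : ℝ} (hρ₀ : 0 ≤ ρ)
    (hρ : 9 * finrank ℚ K ^ 2 / (2 * rootNorm (P : FractionalIdeal (𝓞 K)⁰ K)) ≤ ρ ^ 2)
    (x : RealPlane K) : ∃ w ∈ baseLattice P, ‖x - w‖ ≤ ρ := by
  have hP' : (P : FractionalIdeal (𝓞 K)⁰ K) ≠ 0 := coeIdeal_ne_zero.mpr hP
  have hN := rootNorm_pos hP'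
  have hd := rootDiscr_pos (K := K)
  rw [baseLattice_eq_map hc P]
  refine exists_mem_planeLattice_norm_sub_le hb hb1 (scalingFactor_pos hP).ne'
    (one_ne_zero' (FractionalIdeal (𝓞 K)⁰ K)) (mul_ne_zero (inv_ne_zero hP') codifferent_ne_zero)
    le_rfl hρ₀ (le_trans (le_of_eq ?_) hρ) x
  rw [scalingFactor_sq, rootNorm_mul, rootNorm_inv, rootNorm_codifferent, rootNorm_one]
  field_simp
  ring

end Covering

end NormEstimates

/-! ## Averaging over the lines -/

section Lines

open Module

variable {F V : Type*} [Field F] [AddCommGroup V] [Module F V]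

theorem eq_of_mem_of_finrank_eq_one {C D : Submodule F V} (hC : finrank F C = 1)
    (hD : finrank F D = 1) {x : V} (hx : x ≠ 0) (hxC : x ∈ C) (hxD : x ∈ D) : C = D := by
  have hspan {L : Submodule F V} (hL : finrank F L = 1) (hxL : x ∈ L) :
      Submodule.span F {x} = L :=
    have := finite_of_finrank_eq_succ hL
    Submodule.eq_of_le_of_finrank_eq ((Submodule.span_singleton_le_iff_mem _ _).mpr hxL)
      ((finrank_span_singleton hx).trans hL.symm)
  exact (hspan hC hxC).symm.trans (hspan hD hxD)

theorem index_le_natCard_lines [Finite V] {C : Submodule F V} (hC : finrank F C = 1) :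
    C.toAddSubgroup.index ≤ Nat.card {D : Submodule F V // finrank F D = 1} := by
  have := nontrivial_of_finrank_pos (hC ▸ one_pos : 0 < finrank F C)
  obtain ⟨x, hx⟩ := exists_ne (0 : C)
  have : Finite F := Finite.of_injective (fun a : F => a • x) (smul_left_injective F hx)
  have hcardC : Nat.card C.toAddSubgroup = Nat.card F :=
    (Module.natCard_eq_pow_finrank (K := F) (V := C)).trans (by rw [hC, pow_one])
  have hindex := C.toAddSubgroup.card_mul_index
  rw [hcardC, Projectivization.card' F V,
    Nat.card_congr (Projectivization.equivSubmodule F V)] at hindex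
  have hpos : 0 < C.toAddSubgroup.index := Nat.pos_of_ne_zero AddSubgroup.index_ne_zero_of_finite
  obtain ⟨s, hs⟩ := Nat.exists_eq_add_of_lt (Finite.one_lt_card (α := F))
  rw [hs, show 1 + s + 1 - 1 = s + 1 by omega] at hindex
  by_contra! h
  nlinarith [Nat.mul_le_mul_right (s + 1) (Nat.succ_le_of_lt h)]

end Lines

section CodeLattices

open FractionalIdeal nonZeroDivisors RealSpace Module

variable {K : Type*} [Field K] [NumberField K] {P : Ideal (𝓞 K)}

/-- The lattice `Λ₀` of `baseLattice` as a subgroup of `E`, the form in which the notions for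
Euclidean lattices apply to it. -/
abbrev baseZLattice (P : Ideal (𝓞 K)) : Submodule ℤ (RealPlane K) :=
  (baseLattice P).restrictScalars ℤ

section CodeSpace

variable (C : Submodule (𝓞 K ⧸ P) (CodeSpace P))

theorem codeLattice_le_baseZLattice : codeLattice P C ≤ baseZLattice P :=
  fun _ hx => ((mem_codeLattice P C _).mp hx).1

theorem mk_eq_zero_iff_mem_ideal_smul_baseLattice (x : baseLattice P) :
    (Submodule.Quotient.mk x : CodeSpace P) = 0 ↔ (x : RealPlane K) ∈ P • baseLattice P := by
  rw [Submodule.Quotient.mk_eq_zero, Submodule.mem_smul_top_iff]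

theorem smul_mem_codeLattice (r : 𝓞 K) {x : RealPlane K} (hx : x ∈ codeLattice P C) :
    r • x ∈ codeLattice P C := by
  obtain ⟨hbase, hC⟩ := (mem_codeLattice P C x).mp hx
  exact (mem_codeLattice P C _).mpr ⟨(baseLattice P).smul_mem r hbase,
    C.smul_mem (Ideal.Quotient.mk P r) hC⟩

theorem relIndex_codeLattice :
    (codeLattice P C).toAddSubgroup.relIndex (baseZLattice P).toAddSubgroup =
      C.toAddSubgroup.index := by
  let π : baseLattice P →+ CodeSpace P :=
    (P • (⊤ : Submodule (𝓞 K) (baseLattice P))).mkQ.toAddMonoidHom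
  have hcomap : (codeLattice P C).toAddSubgroup.addSubgroupOf (baseZLattice P).toAddSubgroup =
      C.toAddSubgroup.comap π :=
    AddSubgroup.ext fun x =>
      (mem_codeLattice P C _).trans ⟨fun ⟨_, h⟩ => h, fun h => ⟨x.2, h⟩⟩
  exact (congrArg AddSubgroup.index hcomap).trans <|
    AddSubgroup.index_comap_of_surjective (f := π) _ (Submodule.mkQ_surjective _)

end CodeSpace

theorem eq_of_mem_codeLattice (hP : P.IsMaximal) {C D : Submodule (𝓞 K ⧸ P) (CodeSpace P)}
    (hC : finrank (𝓞 K ⧸ P) C = 1) (hD : finrank (𝓞 K ⧸ P) D = 1) {x : RealPlane K}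
    (hx : x ∉ P • baseLattice P) (hxC : x ∈ codeLattice P C) (hxD : x ∈ codeLattice P D) :
    C = D := by
  obtain ⟨hbase, hxC⟩ := (mem_codeLattice P C x).mp hxC
  obtain ⟨_, hxD⟩ := (mem_codeLattice P D x).mp hxD
  let _ : Field (𝓞 K ⧸ P) := Ideal.Quotient.field P
  exact eq_of_mem_of_finrank_eq_one hC hD
    ((mk_eq_zero_iff_mem_ideal_smul_baseLattice ⟨x, hbase⟩).not.mpr hx) hxC hxD

variable {m : ℕ} {ζ : 𝓞 K}

theorem norm_smul_of_pow_eq_one (hm : m ≠ 0) (hζ : ζ ^ m = 1) (x : RealPlane K) :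
    ‖ζ • x‖ = ‖x‖ := by
  have hτ (τ : K →+* ℂ) : ‖τ (ζ : K)‖ = 1 :=
    Complex.norm_eq_one_of_pow_eq_one (by rw [← map_pow, ← map_pow, hζ, map_one, map_one]) hm
  have hnorm (y : RealSpace K) : ‖(ζ : K) • y‖ ^ 2 = ‖y‖ ^ 2 := by
    simp only [norm_sq, embed_smul, norm_mul, hτ, one_mul]
  rw [← sq_eq_sq₀ (norm_nonneg _) (norm_nonneg _), WithLp.prod_norm_sq_eq_of_L2,
    WithLp.prod_norm_sq_eq_of_L2]
  exact congrArg₂ (· + ·) (hnorm x.fst) (hnorm x.snd)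

theorem injective_primitiveRoot_pow_smul (hP : P.IsMaximal) (hζ : IsPrimitiveRoot ζ m)
    {v : {C : Submodule (𝓞 K ⧸ P) (CodeSpace P) // finrank (𝓞 K ⧸ P) C = 1} → RealPlane K}
    (hv : ∀ C, v C ∈ codeLattice P C.1) (hv' : ∀ C, v C ∉ P • baseLattice P) :
    Function.Injective fun x : _ × Fin m => ζ ^ (x.2 : ℕ) • v x.1 := by
  rintro ⟨C, i⟩ ⟨D, j⟩ h
  simp only at h
  have hne : ζ ^ (i : ℕ) • v C ∉ P • baseLattice P := by
    intro hmem
    apply hv' C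
    have hinv := (P • baseLattice P).smul_mem (ζ ^ (m - i)) hmem
    rwa [smul_smul, ← pow_add, Nat.sub_add_cancel i.2.le, hζ.pow_eq_one, one_smul] at hinv
  obtain rfl : C = D := Subtype.ext <| eq_of_mem_codeLattice hP C.2 D.2 hne
    (smul_mem_codeLattice _ _ (hv C)) (h ▸ smul_mem_codeLattice _ _ (hv D))
  have hvC : v C ≠ 0 := fun h => hv' C (h ▸ zero_mem _)
  have hpow : ((ζ ^ (i : ℕ) : 𝓞 K) : K) = ((ζ ^ (j : ℕ) : 𝓞 K) : K) := smul_left_injective K hvC h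
  exact Prod.ext rfl (Fin.ext (hζ.pow_inj i.2 j.2 (NumberField.RingOfIntegers.ext hpow)))

variable {c : K →+* K} (hc : IsComplexConjugation c)
include hc

theorem isEuclideanLattice_baseZLattice (hP : P ≠ ⊥) : IsEuclideanLattice (baseZLattice P) := by
  have hJ : (P : FractionalIdeal (𝓞 K)⁰ K)⁻¹ * codifferent K ≠ 0 :=
    mul_ne_zero (inv_ne_zero (coeIdeal_ne_zero.mpr hP)) codifferent_ne_zero
  have h1 := one_ne_zero' (FractionalIdeal (𝓞 K)⁰ K)
  rw [baseZLattice, baseLattice_eq_map hc P]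
  exact isEuclideanLattice_planeLattice hc (scalingFactor_pos hP).ne' h1 hJ le_rfl
    (div_ne_zero codifferent_ne_zero hJ) (div_ne_zero codifferent_ne_zero h1)
    (symplecticDual_prodModule h1 hJ).ge

theorem finite_codeSpace (hP : P ≠ ⊥) : Finite (CodeSpace P) := by
  have := finite_quotient hP
  obtain ⟨hdisc, hspan⟩ := isEuclideanLattice_baseZLattice hc hP
  have : IsZLattice ℝ (baseZLattice P) := ⟨hspan⟩
  have : Module.Finite ℤ (baseLattice P) := ZLattice.module_finite ℝ (baseZLattice P)
  have : Module.Finite (𝓞 K) (baseLattice P) := Module.Finite.of_restrictScalars_finite ℤ _ _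
  have : Module.Finite (𝓞 K ⧸ P) (CodeSpace P) := Module.Finite.of_restrictScalars_finite (𝓞 K) _ _
  exact Module.finite_of_finite (𝓞 K ⧸ P)

theorem exists_finrank_eq_one (hP : P.IsMaximal) (hP0 : P ≠ ⊥) :
    ∃ C : Submodule (𝓞 K ⧸ P) (CodeSpace P), finrank (𝓞 K ⧸ P) C = 1 := by
  let _ : Field (𝓞 K ⧸ P) := Ideal.Quotient.field P
  have hmem : planeEmbedding K (scalingFactor P) (1, 0) ∈ baseLattice P := by
    rw [baseLattice_eq_map hc P]
    exact ⟨_, ⟨one_mem_one _, Submodule.zero_mem _⟩, rfl⟩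
  have hnotMem : planeEmbedding K (scalingFactor P) (1, 0) ∉ P • baseLattice P := by
    rw [ideal_smul_baseLattice hc hP0]
    rintro ⟨x, hx, hx1⟩
    obtain rfl := planeEmbedding_injective (scalingFactor_pos hP0).ne' hx1
    have hP1 : P = 1 := coeIdeal_eq_one.mp (le_antisymm coeIdeal_le_one (one_le.mpr hx.1))
    exact hP.ne_top (hP1.trans Ideal.one_eq_top)
  exact ⟨_, finrank_span_singleton (K := 𝓞 K ⧸ P)
    ((mk_eq_zero_iff_mem_ideal_smul_baseLattice ⟨_, hmem⟩).not.mpr hnotMem)⟩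

theorem one_le_natCard_lines_mul_covolume (hP : P.IsPrime) (hP0 : P ≠ ⊥) :
    1 ≤ Nat.card {C : Submodule (𝓞 K ⧸ P) (CodeSpace P) // finrank (𝓞 K ⧸ P) C = 1} *
      ZLattice.covolume (baseZLattice P) := by
  have hmax := hP.isMaximal hP0
  let _ : Field (𝓞 K ⧸ P) := Ideal.Quotient.field P
  have := finite_codeSpace hc hP0
  obtain ⟨hdisc, hspan⟩ := isEuclideanLattice_baseZLattice hc hP0
  have : IsZLattice ℝ (baseZLattice P) := ⟨hspan⟩
  obtain ⟨C, hC⟩ := exists_finrank_eq_one hc hmax hP0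
  have hsymp := isSymplecticLattice_of_mem_lineLattices hc hP hP0 ⟨C, hC, rfl⟩
  have := hsymp.1.1
  have : IsZLattice ℝ (codeLattice P C) := ⟨hsymp.1.2⟩
  have hindex := ZLattice.covolume_div_covolume_eq_relIndex' (codeLattice P C) (baseZLattice P)
    (codeLattice_le_baseZLattice C)
  have hcov := ZLattice.covolume_pos (baseZLattice P) volume
  rw [covolume_eq_one_of_isSymplecticLattice hsymp, relIndex_codeLattice, div_eq_iff hcov.ne']
    at hindex
  rw [hindex]
  gcongr
  exact index_le_natCard_lines hC

/-- The averaging argument: if every line lattice had a short vector, the multiples of these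
vectors by the `m`-th roots of unity would be more short vectors of `Λ₀` than fit in a ball. -/
theorem exists_lineLattice_forall_lt_norm (hP : P.IsPrime) (hP0 : P ≠ ⊥)
    (hζ : IsPrimitiveRoot ζ m) {r ρ : ℝ} (hρ : ∀ x : RealPlane K, ∃ v ∈ baseLattice P, ‖x - v‖ ≤ ρ)
    (hr : ∀ v ∈ P • baseLattice P, v ≠ 0 → r < ‖v‖)
    (hvol : (volume : Measure (RealPlane K)).real (Metric.closedBall 0 (r + ρ)) < m) :
    ∃ Λ ∈ lineLattices P, ∀ v ∈ Λ, v ≠ 0 → r < ‖v‖ := by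
  classical
  have hm : m ≠ 0 := by
    rintro rfl
    exact hvol.not_ge (Nat.cast_zero.trans_le measureReal_nonneg)
  have := finite_codeSpace hc hP0
  obtain ⟨hdisc, hspan⟩ := isEuclideanLattice_baseZLattice hc hP0
  have : IsZLattice ℝ (baseZLattice P) := ⟨hspan⟩
  by_contra! hshort
  choose v hv hv0 hvr using
    fun C : {C : Submodule (𝓞 K ⧸ P) (CodeSpace P) // finrank (𝓞 K ⧸ P) C = 1} =>
      hshort _ ⟨C, C.2, rfl⟩
  have hinj := injective_primitiveRoot_pow_smul (hP.isMaximal hP0) hζ hv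
    fun C hC => (hr _ hC (hv0 C)).not_ge (hvr C)
  let _ := Fintype.ofFinite {C : Submodule (𝓞 K ⧸ P) (CodeSpace P) // finrank (𝓞 K ⧸ P) C = 1}
  let g (x : {C : Submodule (𝓞 K ⧸ P) (CodeSpace P) // finrank (𝓞 K ⧸ P) C = 1} × Fin m) :
      baseZLattice P :=
    ⟨ζ ^ (x.2 : ℕ) • v x.1,
      codeLattice_le_baseZLattice _ (smul_mem_codeLattice _ _ (hv x.1))⟩
  have hcount := card_mul_covolume_le (s := Finset.univ.image g) hρ (r := r) fun w hw => by
    obtain ⟨x, -, rfl⟩ := Finset.mem_image.mp hw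
    exact (norm_smul_of_pow_eq_one hm
      (by rw [← pow_mul, mul_comm, pow_mul, hζ.pow_eq_one, one_pow]) _).trans_le (hvr x.1)
  rw [Finset.card_image_of_injective _ fun x y h => hinj (congrArg Subtype.val h),
    Finset.card_univ, Fintype.card_prod, Fintype.card_fin, ← Nat.card_eq_fintype_card,
    Nat.cast_mul, mul_right_comm] at hcount
  exact hvol.not_ge ((le_mul_of_one_le_left (Nat.cast_nonneg m)
    (one_le_natCard_lines_mul_covolume hc hP hP0)).trans hcount)

end CodeLattices

/-! ## Cyclotomic fields -/

section BallRadius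

open Real

/-- The radius `r` of a ball of volume `V` in dimension `2 * n`, where the volume of a ball is
`r ^ (2 * n) * (π ^ n / n !)`. -/
def evenBallRadius (n : ℕ) (V : ℝ) : ℝ := √((V * n.factorial) ^ (n : ℝ)⁻¹ / π)

variable {n : ℕ} {V : ℝ}

theorem evenBallRadius_nonneg : 0 ≤ evenBallRadius n V := sqrt_nonneg _

theorem evenBallRadius_sq (hV : 0 ≤ V) :
    evenBallRadius n V ^ 2 = (V * n.factorial) ^ (n : ℝ)⁻¹ / π := sq_sqrt (by positivity)

theorem evenBallRadius_pow_mul (hn : n ≠ 0) (hV : 0 ≤ V) :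
    evenBallRadius n V ^ (2 * n) * (π ^ n / n.factorial) = V := by
  rw [pow_mul, evenBallRadius_sq hV, div_pow, rpow_inv_natCast_pow (by positivity) hn]
  field_simp

theorem div_nine_le_evenBallRadius_sq (hn : n ≠ 0) (hV : 1 ≤ V) :
    (n : ℝ) / 9 ≤ evenBallRadius n V ^ 2 := by
  have hfac : (n / exp 1) ^ n ≤ V * n.factorial := by
    rw [div_pow, ← exp_nat_mul, mul_one, div_le_iff₀ (exp_pos _), mul_assoc]
    have hexp := (div_le_iff₀ (by positivity)).mp (pow_div_factorial_le_exp n n.cast_nonneg n)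
    rw [mul_comm] at hexp
    exact hexp.trans (le_mul_of_one_le_left (by positivity) hV)
  have hroot : n / exp 1 ≤ (V * n.factorial) ^ (n : ℝ)⁻¹ :=
    (le_rpow_inv_iff_of_pos (by positivity) (by positivity) (by positivity)).mpr
      (by rwa [rpow_natCast])
  have hexp_pi : exp 1 * π ≤ 9 := by nlinarith [exp_one_lt_d9, pi_lt_d2, pi_pos, exp_pos 1]
  rw [evenBallRadius_sq (zero_le_one.trans hV)]
  calc (n : ℝ) / 9 ≤ n / (exp 1 * π) := by gcongr
    _ = n / exp 1 / π := by rw [div_div]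
    _ ≤ _ := by gcongr

theorem evenBallRadius_sq_lt {x : ℝ} (hn : n ≠ 0) (hV : 0 ≤ V) (hVx : V ≤ x) (hx : 1 ≤ x) :
    evenBallRadius n V ^ 2 < n * x := by
  have hfac : V * n.factorial ≤ (n * x) ^ n := by
    rw [mul_pow, mul_comm]
    gcongr
    · exact_mod_cast n.factorial_le_pow
    · exact hVx.trans (le_self_pow₀ hx hn)
  have hroot : (V * n.factorial) ^ (n : ℝ)⁻¹ ≤ n * x :=
    (rpow_inv_le_iff_of_pos (by positivity) (by positivity) (by positivity)).mpr
      (by rwa [rpow_natCast])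
  rw [evenBallRadius_sq hV]
  exact (div_le_div_of_nonneg_right hroot pi_nonneg).trans_lt
    (div_lt_self (by positivity) (by linarith [pi_gt_three]))

theorem add_pow_le_pow_mul_exp {r ρ : ℝ} (hr : 0 < r) (hρ : 0 ≤ ρ) (k : ℕ) :
    (r + ρ) ^ k ≤ r ^ k * exp (k * (ρ / r)) := by
  rw [exp_nat_mul, ← mul_pow]
  gcongr
  calc r + ρ = r * (ρ / r + 1) := by rw [mul_add, mul_div_cancel₀ _ hr.ne', mul_one, add_comm]
    _ ≤ _ := by gcongr; exact add_one_le_exp _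

/-- A ball of volume `κ * V` may be enlarged by `ρ` without reaching the volume `V`, since this
multiplies its volume by at most `exp (2 * n * ρ / r) < κ⁻¹`. -/
theorem add_evenBallRadius_pow_mul_lt {κ ρ : ℝ} (hκ : κ < 1) (hV : 1 ≤ κ * V) (hV0 : 0 < V)
    (hn : n ≠ 0) (hρ : 0 ≤ ρ) (hρn : 36 * n * ρ ^ 2 < log κ ^ 2) :
    (evenBallRadius n (κ * V) + ρ) ^ (2 * n) * (π ^ n / n.factorial) < V := by
  have hκ0 : 0 < κ := pos_of_mul_pos_left (one_pos.trans_le hV) hV0.le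
  have hr := div_nine_le_evenBallRadius_sq hn hV
  have hr0 : 0 < evenBallRadius n (κ * V) :=
    evenBallRadius_nonneg.lt_of_ne' <| pow_ne_zero_iff two_ne_zero |>.mp <|
      ((by positivity : (0 : ℝ) < n / 9).trans_le hr).ne'
  have hvol := evenBallRadius_pow_mul hn (zero_le_one.trans hV)
  set r := evenBallRadius n (κ * V)
  have hexponent : (2 * n : ℕ) * (ρ / r) < -log κ := by
    refine (abs_lt_of_sq_lt_sq' ?_ (neg_nonneg.mpr (log_nonpos hκ0.le hκ.le))).2
    rw [neg_sq, mul_pow, div_pow, ← mul_div_assoc, div_lt_iff₀ (by positivity)]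
    push_cast
    calc (2 * n : ℝ) ^ 2 * ρ ^ 2 = 36 * n * ρ ^ 2 * (n / 9) := by ring
      _ < log κ ^ 2 * (n / 9) := by gcongr
      _ ≤ _ := by gcongr
  calc (r + ρ) ^ (2 * n) * (π ^ n / n.factorial)
      ≤ r ^ (2 * n) * exp ((2 * n : ℕ) * (ρ / r)) * (π ^ n / n.factorial) := by
        gcongr
        exact add_pow_le_pow_mul_exp hr0 hρ _
    _ = κ * V * exp ((2 * n : ℕ) * (ρ / r)) := by rw [mul_right_comm, hvol]
    _ < κ * V * exp (-log κ) := by gcongr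
    _ = V := by rw [exp_neg, exp_log hκ0]; field_simp

end BallRadius

section Totient

theorem le_totient_sq_of_odd {m : ℕ} (hm : Odd m) : m ≤ m.totient ^ 2 := by
  induction m using Nat.recOnPrimeCoprime with
  | zero => exact Nat.zero_le _
  | prime_pow p n hp =>
    rcases n with _ | k
    · simp
    have hp2 : p ≠ 2 := by
      rintro rfl
      exact absurd hm (by simp [Nat.even_pow])
    obtain ⟨t, rfl⟩ := Nat.exists_eq_add_of_le' (lt_of_le_of_ne' hp.two_le hp2)
    rw [Nat.totient_prime_pow_succ hp, mul_pow, pow_succ]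
    exact Nat.mul_le_mul (Nat.le_self_pow two_ne_zero _)
      (by rw [show t + 3 - 1 = t + 2 by omega]; nlinarith)
  | coprime a b _ _ hab ha hb =>
    rw [Nat.totient_mul hab, mul_pow]
    exact Nat.mul_le_mul (ha (Nat.odd_mul.mp hm).1) (hb (Nat.odd_mul.mp hm).2)

theorem le_two_mul_totient_sq (m : ℕ) : m ≤ 2 * m.totient ^ 2 := by
  rcases eq_or_ne m 0 with rfl | hm
  · simp
  obtain ⟨k, n, hn, rfl⟩ := Nat.exists_eq_two_pow_mul_odd hm
  have htwo : 2 ^ k ≤ 2 * (2 ^ k).totient ^ 2 := by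
    rcases k with _ | k
    · simp
    · rw [Nat.totient_prime_pow_succ Nat.prime_two, pow_succ']
      exact Nat.mul_le_mul_left 2 ((Nat.le_self_pow two_ne_zero _).trans_eq (by simp))
  rw [Nat.totient_mul (Nat.Coprime.pow_left k hn.coprime_two_left), mul_pow, ← mul_assoc]
  exact Nat.mul_le_mul htwo (le_totient_sq_of_odd hn)

end Totient

section Density

open Module RealSpace nonZeroDivisors

variable {K : Type*} [Field K] [NumberField K] {P : Ideal (𝓞 K)} {m : ℕ}

theorem exists_lineLattice_le_latticeDensity {ι : Type*} {b : Basis ι ℚ K}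
    (hb : ∀ i, IsIntegral ℤ (b i)) (hb1 : ∀ i (τ : K →+* ℂ), ‖τ (b i)‖ ≤ 1) {c : K →+* K}
    (hc : IsComplexConjugation c) (hP : P.IsPrime) (hP0 : P ≠ ⊥) {ζ : 𝓞 K}
    (hζ : IsPrimitiveRoot ζ m) (hm : 1 ≤ m) (hdiscr : NumberField.rootDiscr K ≤ m) {κ : ℝ}
    (hκ : κ < 1) (hκm : 1 ≤ κ * m)
    (hmP : (m : ℝ) ^ 2 ≤ rootNorm (P : FractionalIdeal (𝓞 K)⁰ K))
    (hκP : 162 * (finrank ℚ K : ℝ) ^ 3 <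
      Real.log κ ^ 2 * rootNorm (P : FractionalIdeal (𝓞 K)⁰ K)) :
    ∃ Λ ∈ lineLattices P, κ * m / 2 ^ (2 * finrank ℚ K) ≤ latticeDensity Λ := by
  have hmR : (1 : ℝ) ≤ m := by exact_mod_cast hm
  have hn : finrank ℚ K ≠ 0 := finrank_pos.ne'
  have hE := finrank_realPlane K
  have : Nontrivial (RealPlane K) := nontrivial_of_finrank_pos (R := ℝ) (by omega)
  have hS : 0 < rootNorm (P : FractionalIdeal (𝓞 K)⁰ K) :=
    (by positivity : (0 : ℝ) < m ^ 2).trans_le hmP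
  set n := finrank ℚ K
  set S := rootNorm (P : FractionalIdeal (𝓞 K)⁰ K)
  let r := evenBallRadius n (κ * m)
  let ρ := √(9 * n ^ 2 / (2 * S))
  have hρ : ρ ^ 2 = 9 * n ^ 2 / (2 * S) := Real.sq_sqrt (by positivity)
  have hr : r ^ 2 < n * (S / NumberField.rootDiscr K) := by
    refine (evenBallRadius_sq_lt hn (zero_le_one.trans hκm)
      (mul_le_of_le_one_left (Nat.cast_nonneg m) hκ.le) hmR).trans_le ?_
    gcongr
    rw [le_div_iff₀ rootDiscr_pos]
    exact (mul_le_mul_of_nonneg_left hdiscr (Nat.cast_nonneg m)).trans ((sq (m : ℝ)).ge.trans hmP)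
  obtain ⟨Λ, hΛ, hmin⟩ := exists_lineLattice_forall_lt_norm hc hP hP0 hζ (r := r) (ρ := ρ)
    (exists_mem_baseLattice_norm_sub_le hb hb1 hc hP0 (Real.sqrt_nonneg _) hρ.ge)
    (fun v hv hv0 => lt_of_pow_lt_pow_left₀ 2 (norm_nonneg v)
      (hr.trans_le (le_norm_sq_of_mem_ideal_smul_baseLattice hc hP0 hv hv0)))
    (by
      rw [volume_real_closedBall_of_finrank_eq_two_mul hE _
        (add_nonneg evenBallRadius_nonneg (Real.sqrt_nonneg _))]
      refine add_evenBallRadius_pow_mul_lt hκ hκm (by positivity) hn (Real.sqrt_nonneg _) ?_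
      rw [hρ, ← mul_div_assoc, div_lt_iff₀ (by positivity)]
      linarith)
  have hsymp := isSymplecticLattice_of_mem_lineLattices hc hP hP0 hΛ
  refine ⟨Λ, hΛ, le_trans (le_of_eq ?_) (le_latticeDensity hsymp.1 fun v hv hv0 =>
    (hmin v hv hv0).le)⟩
  rw [covolume_eq_one_of_isSymplecticLattice hsymp, mul_one, hE,
    volume_real_closedBall_of_finrank_eq_two_mul hE _ evenBallRadius_nonneg,
    evenBallRadius_pow_mul hn (zero_le_one.trans hκm)]

end Density

section Cyclotomic

open Module RealSpace

variable (m : ℕ) (K : Type*) [Field K] [NumberField K] [IsCyclotomicExtension {m} ℚ K]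

theorem exists_isComplexConjugation_of_isCyclotomicExtension (hm : 2 < m) :
    ∃ c : K →+* K, IsComplexConjugation c :=
  have : NumberField.IsCMField K := IsCyclotomicExtension.Rat.isCMField K (S := {m}) ⟨m, rfl, hm⟩
  ⟨NumberField.IsCMField.complexConj K, NumberField.IsCMField.complexEmbedding_complexConj K⟩

variable [NeZero m]

theorem rootDiscr_le_of_isCyclotomicExtension : NumberField.rootDiscr K ≤ m := by
  have hdiscr : (NumberField.discr K).natAbs ≤ m ^ finrank ℚ K := by
    rw [IsCyclotomicExtension.Rat.natAbs_discr m K, IsCyclotomicExtension.Rat.finrank m K]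
    exact Nat.div_le_self _ _
  rw [NumberField.rootDiscr_def, Int.abs_eq_natAbs, Int.cast_natCast,
    Real.rpow_inv_le_iff_of_pos (Nat.cast_nonneg _) (Nat.cast_nonneg m)
      (Nat.cast_pos.mpr finrank_pos), Real.rpow_natCast]
  exact_mod_cast hdiscr

variable {m K}

theorem exists_lineLattice_le_latticeDensity_of_isCyclotomicExtension (hm : 2 < m)
    {P : Ideal (𝓞 K)} (hP : P.IsPrime) (hP0 : P ≠ ⊥) {κ : ℝ} (hκ : 1 / 2 ≤ κ) (hκ1 : κ < 1)
    (hφ : (m.totient : ℝ) ^ 2 * m ≤ 1 / 2 * (residueCard P : ℝ) ^ (1 / (m.totient : ℝ)))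
    (hφκ : (m.totient : ℝ) ^ 2 * m ≤
      Real.log κ ^ 2 / 200 * (residueCard P : ℝ) ^ (1 / (m.totient : ℝ))) :
    ∃ Λ ∈ lineLattices P, κ * m / 2 ^ (2 * m.totient) ≤ latticeDensity Λ := by
  obtain ⟨c, hc⟩ := exists_isComplexConjugation_of_isCyclotomicExtension m K hm
  have hζ := IsCyclotomicExtension.zeta_spec m ℚ K
  have hbasis (i) : (hζ.powerBasis ℚ).basis i = IsCyclotomicExtension.zeta m ℚ K ^ (i : ℕ) := by
    rw [PowerBasis.basis_eq_pow, hζ.powerBasis_gen ℚ]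
  have hn := IsCyclotomicExtension.Rat.finrank m K
  have hmR : (2 : ℝ) ≤ m := by exact_mod_cast hm.le
  have hφm : (m.totient : ℝ) ≤ m := by exact_mod_cast m.totient_le
  have hφ0 : 0 < (m.totient : ℝ) := Nat.cast_pos.mpr (Nat.totient_pos.mpr (by omega))
  have hmφ : (m : ℝ) ≤ 2 * m.totient ^ 2 := by exact_mod_cast le_two_mul_totient_sq m
  rw [one_div (m.totient : ℝ), ← hn, ← rootNorm_coeIdeal] at hφ hφκ
  rw [← hn] at hφm hφ0 hmφ ⊢
  refine exists_lineLattice_le_latticeDensity (b := (hζ.powerBasis ℚ).basis)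
    (fun i => hbasis i ▸ (hζ.isIntegral (by omega)).pow _) (fun i τ => ?_) hc hP hP0
    hζ.toInteger_isPrimitiveRoot (by omega) (rootDiscr_le_of_isCyclotomicExtension m K) hκ1
    (by nlinarith) (by nlinarith) ?_
  · rw [hbasis, map_pow, norm_pow, Complex.norm_eq_one_of_pow_eq_one (n := m)
      (by rw [← map_pow, hζ.pow_eq_one, map_one]) (by omega), one_pow]
  · have hcube : (finrank ℚ K : ℝ) ^ 3 ≤ finrank ℚ K ^ 2 * m := by rw [pow_succ]; gcongr
    have hpos : 0 < (finrank ℚ K : ℝ) ^ 3 := by positivity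
    linarith

end Cyclotomic

/-- Instance search does not unify the two `ℚ`-algebra structures on `CyclotomicField m ℚ`. -/
instance isCyclotomicExtension_toRatAlgebra (m : ℕ) :
    @IsCyclotomicExtension {m} ℚ (CyclotomicField m ℚ) _ _ DivisionRing.toRatAlgebra := by
  rw [Subsingleton.elim DivisionRing.toRatAlgebra (CyclotomicField.algebra m ℚ)]
  infer_instance

theorem mainTheorem5_general {ε : ℝ} (hε : 0 < ε) {K : ℕ → Type*} [∀ m, Field (K m)]
    [∀ m, NumberField (K m)] [∀ m, IsCyclotomicExtension {m} ℚ (K m)] {P : ∀ m, Ideal (𝓞 (K m))}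
    (hP : ∀ m, 0 < m → (P m).IsPrime ∧ P m ≠ ⊥)
    (hq : (fun m : ℕ => (m.totient : ℝ) ^ 2 * (m : ℝ)) =o[atTop]
      fun m : ℕ => (residueCard (P m) : ℝ) ^ (1 / (m.totient : ℝ))) :
    ∀ᶠ m : ℕ in atTop,
      Module.finrank ℝ (RealPlane (K m)) = 2 * m.totient ∧
      (∀ Λ ∈ lineLattices (P m), IsSymplecticLattice Λ) ∧
      ∃ Λ ∈ lineLattices (P m),
        (1 - ε) * (m : ℝ) / 2 ^ (2 * m.totient) < latticeDensity Λ := by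
  obtain ⟨κ, hκ, hκ1⟩ : ∃ κ, max (1 - ε) (1 / 2) < κ ∧ κ < 1 :=
    exists_between (max_lt (by linarith) (by norm_num))
  obtain ⟨hκε, hκ⟩ := max_lt_iff.mp hκ
  have hlog : 0 < Real.log κ ^ 2 / 200 := by
    have := (Real.log_neg (by linarith) hκ1).ne
    positivity
  filter_upwards [hq.bound one_half_pos, hq.bound hlog, eventually_gt_atTop 2] with m hφ hφκ hm
  obtain ⟨hprime, hbot⟩ := hP m (by omega)
  have : NeZero m := ⟨by omega⟩
  obtain ⟨c, hc⟩ := exists_isComplexConjugation_of_isCyclotomicExtension m (K m) hm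
  rw [Real.norm_of_nonneg (by positivity), Real.norm_of_nonneg (by positivity)] at hφ hφκ
  obtain ⟨Λ, hΛ, hdensity⟩ := exists_lineLattice_le_latticeDensity_of_isCyclotomicExtension hm
    hprime hbot hκ.le hκ1 hφ hφκ
  refine ⟨by rw [finrank_realPlane, IsCyclotomicExtension.Rat.finrank m (K m)],
    fun _ => isSymplecticLattice_of_mem_lineLattices hc hprime hbot, Λ, hΛ, hdensity.trans_lt' ?_⟩
  have : (0 : ℝ) < m := Nat.cast_pos.mpr (by omega)
  gcongr

end

theorem mainTheorem5 (ε : ℝ) (hε0 : 0 < ε) (hε1 : ε < 1)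
    (P : ∀ m : ℕ, Ideal (𝓞 (CyclotomicField m ℚ)))
    (hP : ∀ m : ℕ, 0 < m → (P m).IsPrime ∧
      ∃ p : ℕ, p.Prime ∧ ¬ p ∣ m ∧ (P m).LiesOver (Ideal.span {(p : ℤ)}))
    (hq : (fun m : ℕ => (m.totient : ℝ) ^ 2 * (m : ℝ)) =o[atTop]
      fun m : ℕ => (residueCard (P m) : ℝ) ^ (1 / (m.totient : ℝ))) :
    ∀ᶠ m : ℕ in atTop,
      Module.finrank ℝ (RealPlane (CyclotomicField m ℚ)) = 2 * m.totient ∧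
      (∀ Λ ∈ lineLattices (P m), IsSymplecticLattice Λ) ∧
      ∃ Λ ∈ lineLattices (P m),
        (1 - ε) * (m : ℝ) / 2 ^ (2 * m.totient) < latticeDensity Λ :=
  mainTheorem5_general hε0 (fun m hm =>
    have ⟨hprime, p, hp, _, hpP⟩ := hP m hm
    ⟨hprime, Ideal.ne_bot_of_liesOver_of_ne_bot (p := Ideal.span {(p : ℤ)})
      (by simpa using hp.ne_zero) (P m)⟩) hq
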